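/- Let $N,M,L,T,P\ge 1$ be integers, let $0<\varepsilon\le 1$, and let $\mathcal Y_p\in\mathbb C^{N\times M\times L\times T}$, $p=1,\dots,P$, be given tensors. For $\theta=(\{a_{p,\mathrm{Tx}}\in\mathbb C^N,\ a_{p,\mathrm{Rx}}\in\mathbb C^M,\ c_p\in\mathbb C^L,\ h_p\in\mathbb C^T\}_{p},\ \{g_{n,\mathrm{Tx}}\in\mathbb R^L\}_{n=1}^N,\ \{g_{m,\mathrm{Rx}}\in\mathbb R^L\}_{m=1}^M)$ put $b_{n,m,p}=g_{n,\mathrm{Tx}}\circ g_{m,\mathrm{Rx}}\circ c_p$ (entrywise product) and $$f(\theta)=\sum_{p,n,m,\ell,t}\bigl|[\mathcal Y_p]_{n,m,\ell,t}-[a_{p,\mathrm{Tx}}]_n[a_{p,\mathrm{Rx}}]_m[b_{n,m,p}]_\ell[h_p]_t\bigr|^2 .$$ The calibration problem is to minimize $f$ subject to, for all $p$: $[a_{p,\mathrm{Tx}}]_1,[a_{p,\mathrm{Rx}}]_1\in\mathbb R$, $\|a_{p,\mathrm{Tx}}\|_2^2=N$, $\|a_{p,\mathrm{Rx}}\|_2^2=M$,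 $[c_p]_1=1$, $|[c_p]_\ell|=1$ for all $\ell$; $g_{1,\mathrm{Tx}}=(1,\dots,1)$; and, for $g=g_{n,\mathrm{Tx}}$ with $n\ge2$ and for $g=g_{m,\mathrm{Rx}}$ with $m\ge 1$: $[g]_\ell\ge\varepsilon$ for all $\ell$ and $\max_\ell [g]_\ell=1$. Let $\mathcal F$ be its feasible set. Let $\Theta$ be the set of all $\theta$ that satisfy only $|[c_p]_\ell|=1$ for all $p,\ell$ (the phases of the $c_p$ are free), $g_{1,\mathrm{Tx}}=(1,\dots,1)$, $[g_{n,\mathrm{Tx}}]_\ell\in[\varepsilon,1]$ for $n\ge2$, and $[g_{m,\mathrm{Rx}}]_\ell\in[\varepsilon,1]$. One iteration of the modified block coordinate descent method applies to $\tilde\theta^{(i)}$ the following updates in this order, each of them with the latest values of all the other blocks (${}^*$ is complex conjugation, and ${}^{\mathsf H}$ and ${}^{\mathsf T}$ are the conjugate transpose and the transpose): $$[a_{p,\mathrm{Tx}}]_n\leftarrow\frac{\sum_m[a_{p,\mathrm{Rx}}]_m^*\,b_{n,m,p}^{\mathsf H}[\mathcal Y_p]_{n,m,:,:}h_p^*}{\|h_p\|_2^2\sum_m|[a_{p,\mathrm{Rx}}]_m|^2\|b_{n,m,p}\|_2^2},\qquad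 [a_{p,\mathrm{Rx}}]_m\leftarrow\frac{\sum_n[a_{p,\mathrm{Tx}}]_n^*\,b_{n,m,p}^{\mathsf H}[\mathcal Y_p]_{n,m,:,:}h_p^*}{\|h_p\|_2^2\sum_n|[a_{p,\mathrm{Tx}}]_n|^2\|b_{n,m,p}\|_2^2},$$ $$[c_p]_\ell\leftarrow e^{\mathrm j\phi_{\ell,p}},\qquad \phi_{\ell,p}=\arg\Bigl(\sum_{n,m}[a_{p,\mathrm{Tx}}]_n^*[a_{p,\mathrm{Rx}}]_m^*[g_{n,\mathrm{Tx}}]_\ell[g_{m,\mathrm{Rx}}]_\ell\,h_p^{\mathsf H}[\mathcal Y_p]_{n,m,\ell,:}\Bigr)\quad(\arg 0:=0),$$ $$[g_{n,\mathrm{Tx}}]_\ell\leftarrow\Pi\left(\frac{\mathrm{Re}\sum_{p,m}[a_{p,\mathrm{Tx}}]_n^*[a_{p,\mathrm{Rx}}]_m^*[c_p]_\ell^*[g_{m,\mathrm{Rx}}]_\ell\,h_p^{\mathsf H}[\mathcal Y_p]_{n,m,\ell,:}}{\sum_{p,m}|[a_{p,\mathrm{Tx}}]_n|^2|[a_{p,\mathrm{Rx}}]_m|^2[g_{m,\mathrm{Rx}}]_\ell^2\|h_p\|_2^2}\right)\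 (n\ge2),\qquad g_{1,\mathrm{Tx}}\leftarrow(1,\dots,1),$$ $$[g_{m,\mathrm{Rx}}]_\ell\leftarrow\Pi\left(\frac{\mathrm{Re}\sum_{p,n}[a_{p,\mathrm{Tx}}]_n^*[a_{p,\mathrm{Rx}}]_m^*[c_p]_\ell^*[g_{n,\mathrm{Tx}}]_\ell\,h_p^{\mathsf H}[\mathcal Y_p]_{n,m,\ell,:}}{\sum_{p,n}|[a_{p,\mathrm{Tx}}]_n|^2|[a_{p,\mathrm{Rx}}]_m|^2[g_{n,\mathrm{Tx}}]_\ell^2\|h_p\|_2^2}\right),$$ $$h_p\leftarrow\frac{\sum_{n,m}[a_{p,\mathrm{Tx}}]_n^*[a_{p,\mathrm{Rx}}]_m^*\,([\mathcal Y_p]_{n,m,:,:})^{\mathsf T}b_{n,m,p}^*}{\sum_{n,m}|[a_{p,\mathrm{Tx}}]_n|^2|[a_{p,\mathrm{Rx}}]_m|^2\|b_{n,m,p}\|_2^2},$$ where $\Pi$ is the projection of $\mathbb R$ onto $[\varepsilon,1]$ and a quotient $0/0$ inside $\Pi$ is read as $0$. The rescaling step then yields $\tilde\theta^{(i+1)}$: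 with $\kappa_{1,\mathrm{Tx}}=1$, $\kappa_{n,\mathrm{Tx}}=(\max_\ell[g_{n,\mathrm{Tx}}]_\ell)^{-1}$ for $n\ge2$, and $\kappa_{m,\mathrm{Rx}}=(\max_\ell[g_{m,\mathrm{Rx}}]_\ell)^{-1}$, $$\tilde g_{n,\mathrm{Tx}}=\kappa_{n,\mathrm{Tx}}g_{n,\mathrm{Tx}},\quad \tilde g_{m,\mathrm{Rx}}=\kappa_{m,\mathrm{Rx}}g_{m,\mathrm{Rx}},\quad [\tilde a_{p,\mathrm{Tx}}]_n=\kappa_{p,a_{\mathrm{Tx}}}\kappa_{n,\mathrm{Tx}}^{-1}[a_{p,\mathrm{Tx}}]_n,\quad [\tilde a_{p,\mathrm{Rx}}]_m=\kappa_{p,a_{\mathrm{Rx}}}\kappa_{m,\mathrm{Rx}}^{-1}[a_{p,\mathrm{Rx}}]_m,$$ $$\tilde c_p=\kappa_{p,c}\,c_p,\quad \kappa_{p,c}=[c_p]_1^*,\qquad \tilde h_p=(\kappa_{p,a_{\mathrm{Tx}}}\kappa_{p,a_{\mathrm{Rx}}}\kappa_{p,c})^{-1}h_p,$$ where $\kappa_{p,a_{\mathrm{Tx}}},\kappa_{p,a_{\mathrm{Rx}}}\in\mathbb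 C$ are any numbers for which $[\tilde a_{p,\mathrm{Tx}}]_1$ and $[\tilde a_{p,\mathrm{Rx}}]_1$ are real, $\|\tilde a_{p,\mathrm{Tx}}\|_2^2=N$ and $\|\tilde a_{p,\mathrm{Rx}}\|_2^2=M$. Let $(\tilde\theta^{(i)})$ be an infinite sequence generated by this method from an arbitrary starting point (so that the method does not break down: no updated steering vector $a_{p,\mathrm{Tx}}$ or $a_{p,\mathrm{Rx}}$ is zero, and every rescaling is possible). Then every limit point $\bar\theta$ of $(\tilde\theta^{(i)})$ is a stationary point of the calibration problem: $\bar\theta\in\mathcal F$, and the derivative of $f$ at $\bar\theta$ is nonnegative along every direction of the (Bouligand) tangent cone of $\mathcal F$ at $\bar\theta$. Moreover $\bar\theta$ satisfies the same first-order condition with the larger set $\Theta$ in place of $\mathcal F$. -/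

import Mathlib

open Filter Topology

noncomputable section

namespace Calibration

/-- The parameters of the tensor model, as a point of a finite-dimensional real normed space: the
transmit steering vectors `a_{p,Tx} ∈ ℂ^N`, the receive steering vectors `a_{p,Rx} ∈ ℂ^M`, the phase
responses `c_p ∈ ℂ^L`, the transmit magnitude responses `g_{n,Tx} ∈ ℝ^L`, the receive magnitude
responses `g_{m,Rx} ∈ ℝ^L`, and the signal gains `h_p ∈ ℂ^T`, in this order. -/
abbrev Params (P N M L T : ℕ) : Type :=
  (Fin P → Fin N → ℂ) × (Fin P → Fin M → ℂ) × (Fin P → Fin L → ℂ) ×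
    (Fin N → Fin L → ℝ) × (Fin M → Fin L → ℝ) × (Fin P → Fin T → ℂ)

/-- The measurement tensors `Y_p ∈ ℂ^{N × M × L × T}`, `p = 1, …, P`. -/
abbrev Data (P N M L T : ℕ) : Type := Fin P → Fin N → Fin M → Fin L → Fin T → ℂ

section

variable {P N M L T : ℕ}

/-- Transmit steering vectors: `θ.aTx p n = [a_{p,Tx}]_n`. -/
abbrev Params.aTx (θ : Params P N M L T) : Fin P → Fin N → ℂ := θ.1

/-- Receive steering vectors: `θ.aRx p m = [a_{p,Rx}]_m`. -/
abbrev Params.aRx (θ : Params P N M L T) : Fin P → Fin M → ℂ := θ.2.1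

/-- Phase responses: `θ.c p ℓ = [c_p]_ℓ`. -/
abbrev Params.c (θ : Params P N M L T) : Fin P → Fin L → ℂ := θ.2.2.1

/-- Transmit magnitude responses: `θ.gTx n ℓ = [g_{n,Tx}]_ℓ`. -/
abbrev Params.gTx (θ : Params P N M L T) : Fin N → Fin L → ℝ := θ.2.2.2.1

/-- Receive magnitude responses: `θ.gRx m ℓ = [g_{m,Rx}]_ℓ`. -/
abbrev Params.gRx (θ : Params P N M L T) : Fin M → Fin L → ℝ := θ.2.2.2.2.1

/-- Signal gains: `θ.h p t = [h_p]_t`. -/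
abbrev Params.h (θ : Params P N M L T) : Fin P → Fin T → ℂ := θ.2.2.2.2.2

/-- The frequency vector `b_{n,m,p} = g_{n,Tx} ∘ g_{m,Rx} ∘ c_p` (entrywise product). -/
def Params.b (θ : Params P N M L T) (n : Fin N) (m : Fin M) (p : Fin P) (l : Fin L) : ℂ :=
  (θ.gTx n l : ℂ) * (θ.gRx m l : ℂ) * θ.c p l

/-- The entry with index `(n, m, l, t)` of the `p`-th noise-free model tensor
`∑_n ∑_m (e_n ∘ a_{p,Tx}) ⊗ (e_m ∘ a_{p,Rx}) ⊗ b_{n,m,p} ⊗ h_p`. -/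
def Params.model (θ : Params P N M L T) (p : Fin P) (n : Fin N) (m : Fin M) (l : Fin L)
    (t : Fin T) : ℂ :=
  θ.aTx p n * θ.aRx p m * θ.b n m p l * θ.h p t

/-- The least-squares cost: the sum over `p` of the squared Frobenius norms of the residuals. -/
def cost (Y : Data P N M L T) (θ : Params P N M L T) : ℝ :=
  ∑ p, ∑ n, ∑ m, ∑ l, ∑ t, ‖Y p n m l t - θ.model p n m l t‖ ^ 2

/-! ### The constraint sets and stationarity -/

/-- The feasible set of the calibration problem. The index `0` is the first sensor or bin. As `ε` is
positive, the requirement that the magnitude responses be nonnegative is implied. -/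
def feasibleSet [NeZero N] [NeZero M] [NeZero L] (ε : ℝ) : Set (Params P N M L T) :=
  {θ | (∀ p, (θ.aTx p 0).im = 0) ∧
    (∀ p, ∑ n, ‖θ.aTx p n‖ ^ 2 = N) ∧
    (∀ p, (θ.aRx p 0).im = 0) ∧
    (∀ p, ∑ m, ‖θ.aRx p m‖ ^ 2 = M) ∧
    (∀ p, θ.c p 0 = 1) ∧
    (∀ p l, l ≠ 0 → ‖θ.c p l‖ = 1) ∧
    (∀ l, θ.gTx 0 l = 1) ∧
    (∀ n l, n ≠ 0 → ε ≤ θ.gTx n l) ∧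
    (∀ n, n ≠ 0 → ⨆ l, θ.gTx n l = 1) ∧
    (∀ m l, ε ≤ θ.gRx m l) ∧
    (∀ m, ⨆ l, θ.gRx m l = 1)}

/-- The larger set in which the scaling constraints are dropped: the steering vectors and gains are
free, the entries of the `c_p` have modulus one (that is, their phases are free), the reference
response is `1`, and the other magnitude responses lie in `[ε, 1]`. -/
def relaxedSet [NeZero N] (ε : ℝ) : Set (Params P N M L T) :=
  {θ | (∀ p l, ‖θ.c p l‖ = 1) ∧
    (∀ l, θ.gTx 0 l = 1) ∧
    (∀ n l, n ≠ 0 → θ.gTx n l ∈ Set.Icc ε 1) ∧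
    (∀ m l, θ.gRx m l ∈ Set.Icc ε 1)}

/-- First-order stationarity of `x` for the minimization of `f` over `S`: the point is feasible, and
the derivative of `f` is nonnegative along every direction of the (Bouligand) tangent cone. -/
def IsStationaryPointOn {E : Type*} [NormedAddCommGroup E] [NormedSpace ℝ E] (f : E → ℝ)
    (S : Set E) (x : E) : Prop :=
  x ∈ S ∧ DifferentiableAt ℝ f x ∧ ∀ d ∈ posTangentConeAt S x, 0 ≤ fderiv ℝ f x d

/-! ### The block updates

Each step computes one block from the current values of all the other blocks. -/

/-- `h_p^H [Y_p]_{n,m,l,:}` -/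
def Params.corr (Y : Data P N M L T) (θ : Params P N M L T) (p : Fin P) (n : Fin N) (m : Fin M)
    (l : Fin L) : ℂ :=
  ∑ t, star (θ.h p t) * Y p n m l t

/-- `‖h_p‖₂²` -/
def Params.hSq (θ : Params P N M L T) (p : Fin P) : ℝ := ∑ t, ‖θ.h p t‖ ^ 2

/-- `‖b_{n,m,p}‖₂²` -/
def Params.bSq (θ : Params P N M L T) (n : Fin N) (m : Fin M) (p : Fin P) : ℝ :=
  ∑ l, ‖θ.b n m p l‖ ^ 2

/-- Closed-form update of the transmit steering vectors. -/
def newATx (Y : Data P N M L T) (θ : Params P N M L T) (p : Fin P) (n : Fin N) : ℂ :=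
  ((θ.hSq p * ∑ m, ‖θ.aRx p m‖ ^ 2 * θ.bSq n m p : ℝ) : ℂ)⁻¹ *
    ∑ m, star (θ.aRx p m) * ∑ l, star (θ.b n m p l) * θ.corr Y p n m l

/-- Closed-form update of the receive steering vectors. -/
def newARx (Y : Data P N M L T) (θ : Params P N M L T) (p : Fin P) (m : Fin M) : ℂ :=
  ((θ.hSq p * ∑ n, ‖θ.aTx p n‖ ^ 2 * θ.bSq n m p : ℝ) : ℂ)⁻¹ *
    ∑ n, star (θ.aTx p n) * ∑ l, star (θ.b n m p l) * θ.corr Y p n m l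

/-- Closed-form update of the phases. -/
def newPhase (Y : Data P N M L T) (θ : Params P N M L T) (p : Fin P) (l : Fin L) : ℝ :=
  Complex.arg (∑ n, ∑ m, star (θ.aTx p n) * star (θ.aRx p m) * (θ.gTx n l : ℂ) * (θ.gRx m l : ℂ) *
    θ.corr Y p n m l)

/-- Update of the phase responses, `[c_p]_ℓ = exp (j φ_{ℓ,p})`. -/
def newC (Y : Data P N M L T) (θ : Params P N M L T) (p : Fin P) (l : Fin L) : ℂ :=
  Complex.exp (Complex.I * (newPhase Y θ p l : ℂ))

/-- Projection of a real number onto `[ε, 1]`. -/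
def clip (ε x : ℝ) : ℝ := if 1 < x then 1 else if ε ≤ x then x else ε

/-- Unconstrained least-squares solution for the transmit magnitude responses. -/
def lsGTx (Y : Data P N M L T) (θ : Params P N M L T) (n : Fin N) (l : Fin L) : ℝ :=
  (∑ p, ∑ m, star (θ.aTx p n) * star (θ.aRx p m) * star (θ.c p l) * (θ.gRx m l : ℂ) *
      θ.corr Y p n m l).re /
    ∑ p, ∑ m, ‖θ.aTx p n‖ ^ 2 * ‖θ.aRx p m‖ ^ 2 * θ.gRx m l ^ 2 * θ.hSq p

/-- Closed-form update of the transmit magnitude responses; the reference one is fixed. -/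
def newGTx [NeZero N] (ε : ℝ) (Y : Data P N M L T) (θ : Params P N M L T) (n : Fin N)
    (l : Fin L) : ℝ :=
  if n = 0 then 1 else clip ε (lsGTx Y θ n l)

/-- Unconstrained least-squares solution for the receive magnitude responses. -/
def lsGRx (Y : Data P N M L T) (θ : Params P N M L T) (m : Fin M) (l : Fin L) : ℝ :=
  (∑ p, ∑ n, star (θ.aTx p n) * star (θ.aRx p m) * star (θ.c p l) * (θ.gTx n l : ℂ) *
      θ.corr Y p n m l).re /
    ∑ p, ∑ n, ‖θ.aTx p n‖ ^ 2 * ‖θ.aRx p m‖ ^ 2 * θ.gTx n l ^ 2 * θ.hSq p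

/-- Closed-form update of the receive magnitude responses. -/
def newGRx (ε : ℝ) (Y : Data P N M L T) (θ : Params P N M L T) (m : Fin M) (l : Fin L) : ℝ :=
  clip ε (lsGRx Y θ m l)

/-- Closed-form update of the gains. -/
def newH (Y : Data P N M L T) (θ : Params P N M L T) (p : Fin P) (t : Fin T) : ℂ :=
  (∑ n, ∑ m, star (θ.aTx p n) * star (θ.aRx p m) * ∑ l, Y p n m l t * star (θ.b n m p l)) /
    ((∑ n, ∑ m, ‖θ.aTx p n‖ ^ 2 * ‖θ.aRx p m‖ ^ 2 * θ.bSq n m p : ℝ) : ℂ)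

/-- Replace the transmit steering vectors by their update. -/
def stepATx (Y : Data P N M L T) (θ : Params P N M L T) : Params P N M L T :=
  (newATx Y θ, θ.aRx, θ.c, θ.gTx, θ.gRx, θ.h)

/-- Replace the receive steering vectors by their update. -/
def stepARx (Y : Data P N M L T) (θ : Params P N M L T) : Params P N M L T :=
  (θ.aTx, newARx Y θ, θ.c, θ.gTx, θ.gRx, θ.h)

/-- Replace the phase responses by their update. -/
def stepC (Y : Data P N M L T) (θ : Params P N M L T) : Params P N M L T :=
  (θ.aTx, θ.aRx, newC Y θ, θ.gTx, θ.gRx, θ.h)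

/-- Replace the transmit magnitude responses by their update. -/
def stepGTx [NeZero N] (ε : ℝ) (Y : Data P N M L T) (θ : Params P N M L T) : Params P N M L T :=
  (θ.aTx, θ.aRx, θ.c, newGTx ε Y θ, θ.gRx, θ.h)

/-- Replace the receive magnitude responses by their update. -/
def stepGRx (ε : ℝ) (Y : Data P N M L T) (θ : Params P N M L T) : Params P N M L T :=
  (θ.aTx, θ.aRx, θ.c, θ.gTx, newGRx ε Y θ, θ.h)

/-- Replace the gains by their update. -/
def stepH (Y : Data P N M L T) (θ : Params P N M L T) : Params P N M L T :=
  (θ.aTx, θ.aRx, θ.c, θ.gTx, θ.gRx, newH Y θ)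

/-- One sweep over all blocks, each update using the latest values of the other blocks. -/
def sweep [NeZero N] (ε : ℝ) (Y : Data P N M L T) (θ : Params P N M L T) : Params P N M L T :=
  stepH Y (stepGRx ε Y (stepGTx ε Y (stepC Y (stepARx Y (stepATx Y θ)))))

/-! ### The rescaling step -/

/-- Scaling factors of the transmit magnitude responses. -/
def kappaGTx [NeZero N] (θ : Params P N M L T) (n : Fin N) : ℝ :=
  if n = 0 then 1 else (⨆ l, θ.gTx n l)⁻¹

/-- Scaling factors of the receive magnitude responses. -/
def kappaGRx (θ : Params P N M L T) (m : Fin M) : ℝ := (⨆ l, θ.gRx m l)⁻¹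

/-- `IsRescaling θ θ'`: the point `θ'` arises from `θ` by the rescaling step. The factors of the
steering vectors are any complex numbers that make the first entries real and give the norms that
the problem prescribes. The entries of the steering vectors are divided by the factors of the
magnitude responses, so that the model tensors do not change. No such `θ'` exists if some steering
vector of `θ` is zero. -/
def IsRescaling [NeZero N] [NeZero M] [NeZero L] (θ θ' : Params P N M L T) : Prop :=
  ∃ (κTx κRx : Fin P → ℂ),
    (∀ p n, θ'.aTx p n = κTx p * ((kappaGTx θ n : ℂ)⁻¹ * θ.aTx p n)) ∧
    (∀ p m, θ'.aRx p m = κRx p * ((kappaGRx θ m : ℂ)⁻¹ * θ.aRx p m)) ∧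
    (∀ p, (θ'.aTx p 0).im = 0) ∧
    (∀ p, ∑ n, ‖θ'.aTx p n‖ ^ 2 = N) ∧
    (∀ p, (θ'.aRx p 0).im = 0) ∧
    (∀ p, ∑ m, ‖θ'.aRx p m‖ ^ 2 = M) ∧
    (∀ p l, θ'.c p l = star (θ.c p 0) * θ.c p l) ∧
    (∀ n l, θ'.gTx n l = kappaGTx θ n * θ.gTx n l) ∧
    (∀ m l, θ'.gRx m l = kappaGRx θ m * θ.gRx m l) ∧
    (∀ p t, θ'.h p t = (κTx p * κRx p * star (θ.c p 0))⁻¹ * θ.h p t)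

/-- A sequence of rescaled iterates of the modified block coordinate descent method, from an
arbitrary starting point. As every rescaling is possible, no steering vector becomes zero after its
update. Hence, once the current point is feasible (at the latest after one iteration), none of the
divisors in the updates of the steering vectors and of the gains is zero. A least-squares quotient
`0 / 0` for a magnitude response is read as `0`, and the argument of `0` as `0`. -/
def IsModifiedBCD [NeZero N] [NeZero M] [NeZero L] (ε : ℝ) (Y : Data P N M L T)
    (θ : ℕ → Params P N M L T) : Prop :=
  ∀ i, IsRescaling (sweep ε Y (θ i)) (θ (i + 1))

end

end Calibration

end

/-!
Write `X = θ.model`. The cost is `‖Y - X‖²`, the model `X` is linear in each block, and rescaling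
does not change it. Parameters of consecutive iterates need not be close: where a gain `h_p` tends
to zero, or where a steering vector entry does, the updates may jump, and so may the phase updates
where the optimal phase is not unique. The models behave better. Each block update other than that
of the phases minimizes a convex quadratic over a convex set, and the optimality condition at the
new point gives `‖X' - X‖² ≤ cost before - cost after` (`modelDist_le_cost_sub`). As the phase
update does not increase the cost, the cost converges along the iterates, and all these changes of
the model tend to zero (`tendsto_zero_of_le_cost_sub`).

Let `θ i → θbar` along an ultrafilter. The models keep the limit `θbar.model` through the two
steering vector updates that follow `θ i`, and, backwards from `θ i`, through the updates after
the phase update of the preceding iteration. The phase update thus never lies between `θ i` and a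
point whose optimality condition is passed to the limit:

* The equations of the steering vectors are taken from the updates that follow `θ i`. For the
  receive side the new transmit vectors must converge to those of `θbar`; this holds if the limit
  gain is not zero (`tendsto_newATx`), and otherwise the equation is trivial.
* The equations of the gains hold exactly at `θ i`, since rescaling preserves them.
* The conditions on phases and magnitude responses are taken from the preceding iteration.
  Multiplied by the conjugate entry of the block, they only involve the model and the magnitude
  responses (`corrC`, `corrGTx`, `corrGRx`), so that convergence of the models suffices.

Rescaling a magnitude response `g` could break its condition on the box `[ε, 1]`, as entries at
the lower bound move inside. But if `max g < 1`, then all components of the scaled gradient have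
the same sign, and by Euler's identity (`sum_corrGTx_model`) and the equations of the steering
vectors their sum is zero, so they vanish (`sub_inv_iSup_mul_mul_nonpos`).

These blockwise conditions give stationarity on the relaxed set
(`isStationaryPointOn_relaxedSet`), whose tangent cone contains that of the feasible set.
-/

noncomputable section

namespace Calibration

/-! ### Scalar least squares -/

/-- Normal equation of the scalar complex least-squares problem `min_x ∑ i, ‖y i - x * v i‖ ^ 2`. It
also holds for `v = 0`, where the inverse has the value `0`. -/
lemma sum_star_mul_residual_eq_zero {ι : Type*} [Fintype ι] (v y : ι → ℂ) :
    ∑ i, star (v i) *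
      (y i - ((∑ j, ‖v j‖ ^ 2 : ℝ) : ℂ)⁻¹ * (∑ j, star (v j) * y j) * v i) = 0 := by
  have key : ∑ i, star (v i) * v i = ((∑ j, ‖v j‖ ^ 2 : ℝ) : ℂ) := by
    push_cast
    exact Finset.sum_congr rfl fun i _ => Complex.conj_mul' (v i)
  by_cases h : (∑ j, ‖v j‖ ^ 2 : ℝ) = 0
  · have hv : ∀ i, v i = 0 := fun i => by
      simpa using (Finset.sum_eq_zero_iff_of_nonneg (fun i _ => by positivity)).1 h i
    simp [hv]
  · have h' : ((∑ j, ‖v j‖ ^ 2 : ℝ) : ℂ) ≠ 0 := by exact_mod_cast h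
    simp only [mul_sub, Finset.sum_sub_distrib]
    have : ∀ i, star (v i) * (((∑ j, ‖v j‖ ^ 2 : ℝ) : ℂ)⁻¹ * (∑ j, star (v j) * y j) * v i) =
      ((∑ j, ‖v j‖ ^ 2 : ℝ) : ℂ)⁻¹ * (∑ j, star (v j) * y j) * (star (v i) * v i) :=
      fun i => by ring
    simp only [this, ← Finset.mul_sum, key]
    field_simp
    ring

lemma clip_mem_Icc {ε : ℝ} (hε1 : ε ≤ 1) (x : ℝ) : clip ε x ∈ Set.Icc ε 1 := by
  unfold clip
  split_ifs <;> constructor <;> linarith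

/-- Optimality of the clipped quotient for the one-dimensional quadratic `q x² / 2 - r x` on
`[ε, 1]`. -/
lemma sub_clip_mul_nonpos {ε q r x : ℝ} (hq : 0 ≤ q) (h0 : q = 0 → r = 0)
    (hx : x ∈ Set.Icc ε 1) : (x - clip ε (r / q)) * (r - clip ε (r / q) * q) ≤ 0 := by
  rcases hq.eq_or_lt with h | h
  · simp [← h, h0 h.symm]
  · have hr : r - clip ε (r / q) * q = (r / q - clip ε (r / q)) * q := by field_simp
    rw [hr, ← mul_assoc]
    refine mul_nonpos_of_nonpos_of_nonneg ?_ h.le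
    obtain ⟨h1, h2⟩ := hx
    unfold clip
    split_ifs <;> nlinarith

/-- Optimality condition of the box-constrained real least-squares problem
`min_{x ∈ [ε, 1]} ∑ i, ‖y i - x * v i‖ ^ 2`. -/
lemma sub_clip_mul_re_residual_nonpos {ι : Type*} [Fintype ι] (v y : ι → ℂ) {ε x g : ℝ}
    (hg : g = clip ε ((∑ i, star (v i) * y i).re / ∑ i, ‖v i‖ ^ 2)) (hx : x ∈ Set.Icc ε 1) :
    (x - g) * (∑ i, star (v i) * (y i - g * v i)).re ≤ 0 := by
  have key : ∑ i, star (v i) * (y i - g * v i) =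
      ∑ i, star (v i) * y i - ((g * ∑ i, ‖v i‖ ^ 2 : ℝ) : ℂ) := by
    push_cast
    rw [Finset.mul_sum, ← Finset.sum_sub_distrib]
    refine Finset.sum_congr rfl fun i _ => ?_
    rw [← Complex.conj_mul' (v i)]
    simp only [starRingEnd_apply]
    ring
  rw [key, Complex.sub_re, Complex.ofReal_re, hg]
  refine sub_clip_mul_nonpos (by positivity) (fun h => ?_) hx
  have hv : ∀ i, v i = 0 := fun i => by
    simpa using (Finset.sum_eq_zero_iff_of_nonneg (fun i _ => by positivity)).1 h i
  simp [hv]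

section

variable {P N M L T : ℕ}

/-! ### Orders of summation -/

variable {A : Type*} [AddCommMonoid A] (F : Fin P → Fin N → Fin M → Fin L → Fin T → A)

lemma sum_eq_sum_aTx : ∑ p, ∑ n, ∑ m, ∑ l, ∑ t, F p n m l t =
    ∑ p, ∑ n, ∑ i : Fin M × Fin L × Fin T, F p n i.1 i.2.1 i.2.2 := by
  simp only [Fintype.sum_prod_type]

lemma sum_eq_sum_aRx : ∑ p, ∑ n, ∑ m, ∑ l, ∑ t, F p n m l t =
    ∑ p, ∑ m, ∑ i : Fin N × Fin L × Fin T, F p i.1 m i.2.1 i.2.2 := by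
  simp only [Fintype.sum_prod_type]
  exact Finset.sum_congr rfl fun p _ => Finset.sum_comm

lemma sum_eq_sum_c : ∑ p, ∑ n, ∑ m, ∑ l, ∑ t, F p n m l t =
    ∑ p, ∑ l, ∑ i : Fin N × Fin M × Fin T, F p i.1 i.2.1 l i.2.2 := by
  refine Finset.sum_congr rfl fun p _ => ?_
  simp only [← Fintype.sum_prod_type']
  exact Fintype.sum_equiv
    ⟨fun x => (x.2.2.1, x.1, x.2.1, x.2.2.2), fun x => (x.2.1, x.2.2.1, x.1, x.2.2.2),
      fun _ => rfl, fun _ => rfl⟩ _ _ fun _ => rfl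

lemma sum_eq_sum_gTx : ∑ p, ∑ n, ∑ m, ∑ l, ∑ t, F p n m l t =
    ∑ n, ∑ l, ∑ i : Fin P × Fin M × Fin T, F i.1 n i.2.1 l i.2.2 := by
  simp only [← Fintype.sum_prod_type']
  exact Fintype.sum_equiv
    ⟨fun x => (x.2.1, x.2.2.2.1, x.1, x.2.2.1, x.2.2.2.2),
      fun x => (x.2.2.1, x.1, x.2.2.2.1, x.2.1, x.2.2.2.2),
      fun _ => rfl, fun _ => rfl⟩ _ _ fun _ => rfl

lemma sum_eq_sum_gRx : ∑ p, ∑ n, ∑ m, ∑ l, ∑ t, F p n m l t =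
    ∑ m, ∑ l, ∑ i : Fin P × Fin N × Fin T, F i.1 i.2.1 m l i.2.2 := by
  simp only [← Fintype.sum_prod_type']
  exact Fintype.sum_equiv
    ⟨fun x => (x.2.2.1, x.2.2.2.1, x.1, x.2.1, x.2.2.2.2),
      fun x => (x.2.2.1, x.2.2.2.1, x.1, x.2.1, x.2.2.2.2),
      fun _ => rfl, fun _ => rfl⟩ _ _ fun _ => rfl

lemma sum_eq_sum_h : ∑ p, ∑ n, ∑ m, ∑ l, ∑ t, F p n m l t =
    ∑ p, ∑ t, ∑ i : Fin N × Fin M × Fin L, F p i.1 i.2.1 i.2.2 t := by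
  refine Finset.sum_congr rfl fun p _ => ?_
  simp only [← Fintype.sum_prod_type']
  exact Fintype.sum_equiv
    ⟨fun x => (x.2.2.2, x.1, x.2.1, x.2.2.1), fun x => (x.2.1, x.2.2.1, x.2.2.2, x.1),
      fun _ => rfl, fun _ => rfl⟩ _ _ fun _ => rfl

end

section

variable {P N M L T : ℕ}

/-! ### Regressors and block gradients -/

/-- Factor of `[a_{p,Tx}]_n` in the model entry with index `(p, n, i)`. -/
def Params.regATx (θ : Params P N M L T) (p : Fin P) (n : Fin N)
    (i : Fin M × Fin L × Fin T) : ℂ :=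
  θ.aRx p i.1 * θ.b n i.1 p i.2.1 * θ.h p i.2.2

/-- Factor of `[a_{p,Rx}]_m` in the model entries. -/
def Params.regARx (θ : Params P N M L T) (p : Fin P) (m : Fin M)
    (i : Fin N × Fin L × Fin T) : ℂ :=
  θ.aTx p i.1 * θ.b i.1 m p i.2.1 * θ.h p i.2.2

/-- Factor of `[c_p]_l` in the model entries. -/
def Params.regC (θ : Params P N M L T) (p : Fin P) (l : Fin L)
    (i : Fin N × Fin M × Fin T) : ℂ :=
  θ.aTx p i.1 * θ.aRx p i.2.1 * (θ.gTx i.1 l : ℂ) * (θ.gRx i.2.1 l : ℂ) * θ.h p i.2.2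

/-- Factor of `[g_{n,Tx}]_l` in the model entries. -/
def Params.regGTx (θ : Params P N M L T) (n : Fin N) (l : Fin L)
    (i : Fin P × Fin M × Fin T) : ℂ :=
  θ.aTx i.1 n * θ.aRx i.1 i.2.1 * θ.c i.1 l * (θ.gRx i.2.1 l : ℂ) * θ.h i.1 i.2.2

/-- Factor of `[g_{m,Rx}]_l` in the model entries. -/
def Params.regGRx (θ : Params P N M L T) (m : Fin M) (l : Fin L)
    (i : Fin P × Fin N × Fin T) : ℂ :=
  θ.aTx i.1 i.2.1 * θ.aRx i.1 m * θ.c i.1 l * (θ.gTx i.2.1 l : ℂ) * θ.h i.1 i.2.2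

/-- Factor of `[h_p]_t` in the model entries; it does not depend on `t`. -/
def Params.regH (θ : Params P N M L T) (p : Fin P) (i : Fin N × Fin M × Fin L) : ℂ :=
  θ.aTx p i.1 * θ.aRx p i.2.1 * θ.b i.1 i.2.1 p i.2.2

/-- Correlation of the residual with the regressor of `[a_{p,Tx}]_n`. Up to the factor `-2` this and
its analogues for the other blocks are the partial gradients of the cost. -/
def gradATx (Y : Data P N M L T) (θ : Params P N M L T) (p : Fin P) (n : Fin N) : ℂ :=
  ∑ i, star (θ.regATx p n i) * (Y p n i.1 i.2.1 i.2.2 - θ.model p n i.1 i.2.1 i.2.2)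

/-- Correlation of the residual with the regressor of `[a_{p,Rx}]_m`. -/
def gradARx (Y : Data P N M L T) (θ : Params P N M L T) (p : Fin P) (m : Fin M) : ℂ :=
  ∑ i, star (θ.regARx p m i) * (Y p i.1 m i.2.1 i.2.2 - θ.model p i.1 m i.2.1 i.2.2)

/-- Correlation of the residual with the regressor of `[c_p]_l`. -/
def gradC (Y : Data P N M L T) (θ : Params P N M L T) (p : Fin P) (l : Fin L) : ℂ :=
  ∑ i, star (θ.regC p l i) * (Y p i.1 i.2.1 l i.2.2 - θ.model p i.1 i.2.1 l i.2.2)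

/-- Correlation of the residual with the regressor of `[g_{n,Tx}]_l`. -/
def gradGTx (Y : Data P N M L T) (θ : Params P N M L T) (n : Fin N) (l : Fin L) : ℂ :=
  ∑ i, star (θ.regGTx n l i) * (Y i.1 n i.2.1 l i.2.2 - θ.model i.1 n i.2.1 l i.2.2)

/-- Correlation of the residual with the regressor of `[g_{m,Rx}]_l`. -/
def gradGRx (Y : Data P N M L T) (θ : Params P N M L T) (m : Fin M) (l : Fin L) : ℂ :=
  ∑ i, star (θ.regGRx m l i) * (Y i.1 i.2.1 m l i.2.2 - θ.model i.1 i.2.1 m l i.2.2)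

/-- Correlation of the residual with the regressor of `[h_p]_t`. -/
def gradH (Y : Data P N M L T) (θ : Params P N M L T) (p : Fin P) (t : Fin T) : ℂ :=
  ∑ i, star (θ.regH p i) * (Y p i.1 i.2.1 i.2.2 t - θ.model p i.1 i.2.1 i.2.2 t)

variable (Y : Data P N M L T) (θ : Params P N M L T)

lemma model_eq_aTx_mul (p : Fin P) (n : Fin N) (i : Fin M × Fin L × Fin T) :
    θ.model p n i.1 i.2.1 i.2.2 = θ.aTx p n * θ.regATx p n i := by
  simp only [Params.model, Params.regATx]; ring

lemma model_eq_aRx_mul (p : Fin P) (m : Fin M) (i : Fin N × Fin L × Fin T) :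
    θ.model p i.1 m i.2.1 i.2.2 = θ.aRx p m * θ.regARx p m i := by
  simp only [Params.model, Params.regARx]; ring

lemma model_eq_c_mul (p : Fin P) (l : Fin L) (i : Fin N × Fin M × Fin T) :
    θ.model p i.1 i.2.1 l i.2.2 = θ.c p l * θ.regC p l i := by
  simp only [Params.model, Params.regC, Params.b]; ring

lemma model_eq_gTx_mul (n : Fin N) (l : Fin L) (i : Fin P × Fin M × Fin T) :
    θ.model i.1 n i.2.1 l i.2.2 = θ.gTx n l * θ.regGTx n l i := by
  simp only [Params.model, Params.regGTx, Params.b]; ring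

lemma model_eq_gRx_mul (m : Fin M) (l : Fin L) (i : Fin P × Fin N × Fin T) :
    θ.model i.1 i.2.1 m l i.2.2 = θ.gRx m l * θ.regGRx m l i := by
  simp only [Params.model, Params.regGRx, Params.b]; ring

lemma model_eq_h_mul (p : Fin P) (t : Fin T) (i : Fin N × Fin M × Fin L) :
    θ.model p i.1 i.2.1 i.2.2 t = θ.h p t * θ.regH p i := by
  simp only [Params.model, Params.regH]; ring

/-! ### The updates as least-squares solutions -/

lemma newATx_eq (p : Fin P) (n : Fin N) :
    newATx Y θ p n = ((∑ i, ‖θ.regATx p n i‖ ^ 2 : ℝ) : ℂ)⁻¹ *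
      ∑ i : Fin M × Fin L × Fin T, star (θ.regATx p n i) * Y p n i.1 i.2.1 i.2.2 := by
  unfold newATx
  refine congrArg₂ (fun (r : ℝ) (z : ℂ) => (r : ℂ)⁻¹ * z) ?_ ?_
  · simp only [Params.hSq, Params.bSq, Params.regATx, Fintype.sum_prod_type, Finset.mul_sum,
      Finset.sum_mul, norm_mul, mul_pow]
    exact Finset.sum_congr rfl fun m _ => Finset.sum_congr rfl fun l _ =>
      Finset.sum_congr rfl fun t _ => by ring
  · simp only [Params.corr, Params.regATx, Fintype.sum_prod_type, Finset.mul_sum, star_mul']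
    exact Finset.sum_congr rfl fun m _ => Finset.sum_congr rfl fun l _ =>
      Finset.sum_congr rfl fun t _ => by ring

lemma newARx_eq (p : Fin P) (m : Fin M) :
    newARx Y θ p m = ((∑ i, ‖θ.regARx p m i‖ ^ 2 : ℝ) : ℂ)⁻¹ *
      ∑ i : Fin N × Fin L × Fin T, star (θ.regARx p m i) * Y p i.1 m i.2.1 i.2.2 := by
  unfold newARx
  refine congrArg₂ (fun (r : ℝ) (z : ℂ) => (r : ℂ)⁻¹ * z) ?_ ?_
  · simp only [Params.hSq, Params.bSq, Params.regARx, Fintype.sum_prod_type, Finset.mul_sum,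
      Finset.sum_mul, norm_mul, mul_pow]
    exact Finset.sum_congr rfl fun m _ => Finset.sum_congr rfl fun l _ =>
      Finset.sum_congr rfl fun t _ => by ring
  · simp only [Params.corr, Params.regARx, Fintype.sum_prod_type, Finset.mul_sum, star_mul']
    exact Finset.sum_congr rfl fun m _ => Finset.sum_congr rfl fun l _ =>
      Finset.sum_congr rfl fun t _ => by ring

lemma newH_eq (p : Fin P) (t : Fin T) :
    newH Y θ p t = ((∑ i, ‖θ.regH p i‖ ^ 2 : ℝ) : ℂ)⁻¹ *
      ∑ i : Fin N × Fin M × Fin L, star (θ.regH p i) * Y p i.1 i.2.1 i.2.2 t := by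
  unfold newH
  rw [div_eq_inv_mul]
  refine congrArg₂ (fun (r : ℝ) (z : ℂ) => (r : ℂ)⁻¹ * z) ?_ ?_
  · simp only [Params.bSq, Params.regH, Fintype.sum_prod_type, Finset.mul_sum, norm_mul, mul_pow]
  · simp only [Params.regH, Fintype.sum_prod_type, Finset.mul_sum, star_mul']
    exact Finset.sum_congr rfl fun m _ => Finset.sum_congr rfl fun l _ =>
      Finset.sum_congr rfl fun t _ => by ring

variable {θ}

lemma lsGTx_eq (hc : ∀ p l, ‖θ.c p l‖ = 1) (n : Fin N) (l : Fin L) :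
    lsGTx Y θ n l = (∑ i : Fin P × Fin M × Fin T,
      star (θ.regGTx n l i) * Y i.1 n i.2.1 l i.2.2).re / ∑ i, ‖θ.regGTx n l i‖ ^ 2 := by
  unfold lsGTx
  refine congrArg₂ (fun (z : ℂ) (r : ℝ) => z.re / r) ?_ ?_
  · simp only [Params.corr, Params.regGTx, Fintype.sum_prod_type, Finset.mul_sum, star_mul',
      Complex.star_def, Complex.conj_ofReal]
    exact Finset.sum_congr rfl fun m _ => Finset.sum_congr rfl fun l _ =>
      Finset.sum_congr rfl fun t _ => by ring
  · simp only [Params.hSq, Params.regGTx, Fintype.sum_prod_type, Finset.mul_sum, norm_mul, mul_pow,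
      hc, Complex.norm_real, Real.norm_eq_abs, sq_abs, mul_one]

lemma lsGRx_eq (hc : ∀ p l, ‖θ.c p l‖ = 1) (m : Fin M) (l : Fin L) :
    lsGRx Y θ m l = (∑ i : Fin P × Fin N × Fin T,
      star (θ.regGRx m l i) * Y i.1 i.2.1 m l i.2.2).re / ∑ i, ‖θ.regGRx m l i‖ ^ 2 := by
  unfold lsGRx
  refine congrArg₂ (fun (z : ℂ) (r : ℝ) => z.re / r) ?_ ?_
  · simp only [Params.corr, Params.regGRx, Fintype.sum_prod_type, Finset.mul_sum, star_mul',
      Complex.star_def, Complex.conj_ofReal]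
    exact Finset.sum_congr rfl fun m _ => Finset.sum_congr rfl fun l _ =>
      Finset.sum_congr rfl fun t _ => by ring
  · simp only [Params.hSq, Params.regGRx, Fintype.sum_prod_type, Finset.mul_sum, norm_mul, mul_pow,
      hc, Complex.norm_real, Real.norm_eq_abs, sq_abs, mul_one]

variable (θ)

/-! ### Optimality conditions after each update -/

lemma gradATx_stepATx (p : Fin P) (n : Fin N) : gradATx Y (stepATx Y θ) p n = 0 := by
  unfold gradATx
  simp only [model_eq_aTx_mul]
  rw [← sum_star_mul_residual_eq_zero (θ.regATx p n) fun i => Y p n i.1 i.2.1 i.2.2, ← newATx_eq]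
  rfl

lemma gradARx_stepARx (p : Fin P) (m : Fin M) : gradARx Y (stepARx Y θ) p m = 0 := by
  unfold gradARx
  simp only [model_eq_aRx_mul]
  rw [← sum_star_mul_residual_eq_zero (θ.regARx p m) fun i => Y p i.1 m i.2.1 i.2.2, ← newARx_eq]
  rfl

lemma gradH_stepH (p : Fin P) (t : Fin T) : gradH Y (stepH Y θ) p t = 0 := by
  unfold gradH
  simp only [model_eq_h_mul]
  rw [← sum_star_mul_residual_eq_zero (θ.regH p) fun i => Y p i.1 i.2.1 i.2.2 t, ← newH_eq]
  rfl

variable {θ}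

lemma sub_mul_gradGTx_stepGTx_nonpos [NeZero N] {ε x : ℝ} (hc : ∀ p l, ‖θ.c p l‖ = 1)
    (hx : x ∈ Set.Icc ε 1) {n : Fin N} (hn : n ≠ 0) (l : Fin L) :
    (x - (stepGTx ε Y θ).gTx n l) * (gradGTx Y (stepGTx ε Y θ) n l).re ≤ 0 := by
  unfold gradGTx
  simp only [model_eq_gTx_mul]
  refine sub_clip_mul_re_residual_nonpos (θ.regGTx n l) (fun i => Y i.1 n i.2.1 l i.2.2) ?_ hx
  rw [← lsGTx_eq Y hc]
  exact if_neg hn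

lemma sub_mul_gradGRx_stepGRx_nonpos {ε x : ℝ} (hc : ∀ p l, ‖θ.c p l‖ = 1)
    (hx : x ∈ Set.Icc ε 1) (m : Fin M) (l : Fin L) :
    (x - (stepGRx ε Y θ).gRx m l) * (gradGRx Y (stepGRx ε Y θ) m l).re ≤ 0 := by
  unfold gradGRx
  simp only [model_eq_gRx_mul]
  refine sub_clip_mul_re_residual_nonpos (θ.regGRx m l) (fun i => Y i.1 i.2.1 m l i.2.2) ?_ hx
  rw [← lsGRx_eq Y hc]
  rfl

end

section

variable {P N M L T : ℕ} (Y : Data P N M L T) (θ : Params P N M L T)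

/-! ### Correlations of the model with the residual -/

/-- Correlation of the model slice `X_{p,:,:,l,:}` with the residual. At `X = θ.model` this is
`star (c_{p,l})` times the block gradient, but it only depends on the model tensor. -/
def corrC (X : Data P N M L T) (p : Fin P) (l : Fin L) : ℂ :=
  ∑ i : Fin N × Fin M × Fin T,
    star (X p i.1 i.2.1 l i.2.2) * (Y p i.1 i.2.1 l i.2.2 - X p i.1 i.2.1 l i.2.2)

/-- Correlation of the model slice `X_{:,n,:,l,:}` with the residual. -/
def corrGTx (X : Data P N M L T) (n : Fin N) (l : Fin L) : ℂ :=
  ∑ i : Fin P × Fin M × Fin T,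
    star (X i.1 n i.2.1 l i.2.2) * (Y i.1 n i.2.1 l i.2.2 - X i.1 n i.2.1 l i.2.2)

/-- Correlation of the model slice `X_{:,:,m,l,:}` with the residual. -/
def corrGRx (X : Data P N M L T) (m : Fin M) (l : Fin L) : ℂ :=
  ∑ i : Fin P × Fin N × Fin T,
    star (X i.1 i.2.1 m l i.2.2) * (Y i.1 i.2.1 m l i.2.2 - X i.1 i.2.1 m l i.2.2)

lemma corrC_model (p : Fin P) (l : Fin L) :
    corrC Y θ.model p l = star (θ.c p l) * gradC Y θ p l := by
  simp only [corrC, gradC, model_eq_c_mul, Finset.mul_sum, star_mul']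
  exact Finset.sum_congr rfl fun _ _ => by ring

lemma corrGTx_model (n : Fin N) (l : Fin L) :
    corrGTx Y θ.model n l = θ.gTx n l * gradGTx Y θ n l := by
  simp only [corrGTx, gradGTx, model_eq_gTx_mul, Finset.mul_sum, star_mul', Complex.star_def,
    Complex.conj_ofReal]
  exact Finset.sum_congr rfl fun _ _ => by ring

lemma corrGRx_model (m : Fin M) (l : Fin L) :
    corrGRx Y θ.model m l = θ.gRx m l * gradGRx Y θ m l := by
  simp only [corrGRx, gradGRx, model_eq_gRx_mul, Finset.mul_sum, star_mul', Complex.star_def,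
    Complex.conj_ofReal]
  exact Finset.sum_congr rfl fun _ _ => by ring

/-- Euler's identity for the scaling that is common to `g_{n,Tx}` and `[a_{p,Tx}]_n`. -/
lemma sum_corrGTx_model (n : Fin N) :
    ∑ l, corrGTx Y θ.model n l = ∑ p, star (θ.aTx p n) * gradATx Y θ p n := by
  simp only [corrGTx, gradATx, Fintype.sum_prod_type, Finset.mul_sum]
  rw [Finset.sum_comm]
  refine Finset.sum_congr rfl fun p _ => ?_
  rw [Finset.sum_comm]
  refine Finset.sum_congr rfl fun m _ => Finset.sum_congr rfl fun l _ =>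
    Finset.sum_congr rfl fun t _ => ?_
  rw [← mul_assoc, ← star_mul', ← model_eq_aTx_mul θ p n (m, l, t)]

/-- Euler's identity for the scaling that is common to `g_{m,Rx}` and `[a_{p,Rx}]_m`. -/
lemma sum_corrGRx_model (m : Fin M) :
    ∑ l, corrGRx Y θ.model m l = ∑ p, star (θ.aRx p m) * gradARx Y θ p m := by
  simp only [corrGRx, gradARx, Fintype.sum_prod_type, Finset.mul_sum]
  rw [Finset.sum_comm]
  refine Finset.sum_congr rfl fun p _ => ?_
  rw [Finset.sum_comm]
  refine Finset.sum_congr rfl fun n _ => Finset.sum_congr rfl fun l _ =>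
    Finset.sum_congr rfl fun t _ => ?_
  rw [← mul_assoc, ← star_mul', ← model_eq_aRx_mul θ p m (n, l, t)]

/-! ### The phase update -/

lemma norm_newC (p : Fin P) (l : Fin L) : ‖newC Y θ p l‖ = 1 := by
  rw [newC, mul_comm, Complex.norm_exp_ofReal_mul_I]

lemma newPhase_eq (p : Fin P) (l : Fin L) :
    newPhase Y θ p l = Complex.arg (∑ i : Fin N × Fin M × Fin T,
      star (θ.regC p l i) * Y p i.1 i.2.1 l i.2.2) := by
  unfold newPhase
  congr 1
  simp only [Params.corr, Params.regC, Fintype.sum_prod_type, Finset.mul_sum, star_mul',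
    Complex.star_def, Complex.conj_ofReal]
  exact Finset.sum_congr rfl fun m _ => Finset.sum_congr rfl fun l _ =>
    Finset.sum_congr rfl fun t _ => by ring

lemma star_newC_mul (p : Fin P) (l : Fin L) :
    star (newC Y θ p l) *
        ∑ i : Fin N × Fin M × Fin T, star (θ.regC p l i) * Y p i.1 i.2.1 l i.2.2 =
      ‖∑ i : Fin N × Fin M × Fin T, star (θ.regC p l i) * Y p i.1 i.2.1 l i.2.2‖ := by
  rw [newC, newPhase_eq]
  set z := ∑ i : Fin N × Fin M × Fin T, star (θ.regC p l i) * Y p i.1 i.2.1 l i.2.2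
  rw [Complex.star_def, ← Complex.exp_conj]
  simp only [map_mul, Complex.conj_I, Complex.conj_ofReal]
  calc Complex.exp (-Complex.I * z.arg) * z
      = Complex.exp (-Complex.I * z.arg) * (‖z‖ * Complex.exp (z.arg * Complex.I)) := by
        rw [Complex.norm_mul_exp_arg_mul_I]
    _ = ‖z‖ := by
        rw [mul_left_comm, ← Complex.exp_add, neg_mul, mul_comm, mul_comm (z.arg : ℂ),
          neg_add_cancel, Complex.exp_zero, one_mul]

/-- After the phase update the derivative of the cost with respect to each phase is zero. -/
lemma im_corrC_stepC (p : Fin P) (l : Fin L) : (corrC Y (stepC Y θ).model p l).im = 0 := by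
  have h : corrC Y (stepC Y θ).model p l =
      star (newC Y θ p l) *
        (∑ i : Fin N × Fin M × Fin T, star (θ.regC p l i) * Y p i.1 i.2.1 l i.2.2) -
      ((∑ i : Fin N × Fin M × Fin T, ‖(stepC Y θ).model p i.1 i.2.1 l i.2.2‖ ^ 2 : ℝ) : ℂ) := by
    push_cast
    rw [corrC, Finset.mul_sum, ← Finset.sum_sub_distrib]
    refine Finset.sum_congr rfl fun i _ => ?_
    rw [← Complex.conj_mul', mul_sub, model_eq_c_mul, starRingEnd_apply, star_mul',
      mul_assoc (star ((stepC Y θ).c p l)) _ (Y p i.1 i.2.1 l i.2.2)]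
    rfl
  rw [h, star_newC_mul, Complex.sub_im, Complex.ofReal_im, Complex.ofReal_im, sub_zero]

/-! ### Decrease of the cost -/

/-- Squared Frobenius distance of the models of two parameter points. -/
def modelDist (θ θ' : Params P N M L T) : ℝ :=
  ∑ p, ∑ n, ∑ m, ∑ l, ∑ t, ‖θ'.model p n m l t - θ.model p n m l t‖ ^ 2

lemma modelDist_nonneg (θ θ' : Params P N M L T) : 0 ≤ modelDist θ θ' := by
  unfold modelDist; positivity

/-- If moving from the model of `θ'` back to the model of `θ` is not a descent direction, then the
cost decreases from `θ` to `θ'` by at least the squared distance of the models. -/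
lemma modelDist_le_cost_sub {Y : Data P N M L T} {θ θ' : Params P N M L T}
    (h : 0 ≤ ∑ p, ∑ n, ∑ m, ∑ l, ∑ t, (star (θ'.model p n m l t - θ.model p n m l t) *
      (Y p n m l t - θ'.model p n m l t)).re) :
    modelDist θ θ' ≤ cost Y θ - cost Y θ' := by
  have key : cost Y θ = cost Y θ' +
      2 * ∑ p, ∑ n, ∑ m, ∑ l, ∑ t, (star (θ'.model p n m l t - θ.model p n m l t) *
        (Y p n m l t - θ'.model p n m l t)).re +
      modelDist θ θ' := by
    simp only [cost, modelDist, Finset.mul_sum, ← Finset.sum_add_distrib]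
    refine Finset.sum_congr rfl fun p _ => Finset.sum_congr rfl fun n _ =>
      Finset.sum_congr rfl fun m _ => Finset.sum_congr rfl fun l _ =>
      Finset.sum_congr rfl fun t _ => ?_
    simp only [← Complex.normSq_eq_norm_sq, Complex.normSq_apply, Complex.star_def, Complex.mul_re,
      Complex.sub_re, Complex.sub_im, Complex.conj_re, Complex.conj_im]
    ring
  linarith

lemma norm_model_sub_sq_le (θ θ' : Params P N M L T) (p : Fin P) (n : Fin N) (m : Fin M) (l : Fin L)
    (t : Fin T) : ‖θ'.model p n m l t - θ.model p n m l t‖ ^ 2 ≤ modelDist θ θ' := by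
  refine (Finset.single_le_sum (f := fun t => ‖θ'.model p n m l t - θ.model p n m l t‖ ^ 2)
    (fun _ _ => by positivity) (Finset.mem_univ t)).trans ?_
  refine (Finset.single_le_sum
    (f := fun l => ∑ t, ‖θ'.model p n m l t - θ.model p n m l t‖ ^ 2)
    (fun _ _ => by positivity) (Finset.mem_univ l)).trans ?_
  refine (Finset.single_le_sum
    (f := fun m => ∑ l, ∑ t, ‖θ'.model p n m l t - θ.model p n m l t‖ ^ 2)
    (fun _ _ => by positivity) (Finset.mem_univ m)).trans ?_
  refine (Finset.single_le_sum
    (f := fun n => ∑ m, ∑ l, ∑ t, ‖θ'.model p n m l t - θ.model p n m l t‖ ^ 2)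
    (fun _ _ => by positivity) (Finset.mem_univ n)).trans ?_
  exact Finset.single_le_sum
    (f := fun p => ∑ n, ∑ m, ∑ l, ∑ t, ‖θ'.model p n m l t - θ.model p n m l t‖ ^ 2)
    (fun _ _ => by positivity) (Finset.mem_univ p)

lemma modelDist_stepATx_le :
    modelDist θ (stepATx Y θ) ≤ cost Y θ - cost Y (stepATx Y θ) := by
  refine modelDist_le_cost_sub (le_of_eq ?_)
  rw [sum_eq_sum_aTx]
  refine (Finset.sum_eq_zero fun p _ => Finset.sum_eq_zero fun n _ => ?_).symm
  have h := congrArg (fun z => (star (newATx Y θ p n - θ.aTx p n) * z).re)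
    (gradATx_stepATx Y θ p n)
  simp only [gradATx, Finset.mul_sum, mul_zero, Complex.zero_re, Complex.re_sum] at h
  rw [← h]
  refine Finset.sum_congr rfl fun i _ => ?_
  rw [← mul_assoc, ← star_mul', model_eq_aTx_mul θ, model_eq_aTx_mul (stepATx Y θ), sub_mul]
  rfl

lemma modelDist_stepARx_le :
    modelDist θ (stepARx Y θ) ≤ cost Y θ - cost Y (stepARx Y θ) := by
  refine modelDist_le_cost_sub (le_of_eq ?_)
  rw [sum_eq_sum_aRx]
  refine (Finset.sum_eq_zero fun p _ => Finset.sum_eq_zero fun m _ => ?_).symm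
  have h := congrArg (fun z => (star (newARx Y θ p m - θ.aRx p m) * z).re)
    (gradARx_stepARx Y θ p m)
  simp only [gradARx, Finset.mul_sum, mul_zero, Complex.zero_re, Complex.re_sum] at h
  rw [← h]
  refine Finset.sum_congr rfl fun i _ => ?_
  rw [← mul_assoc, ← star_mul', model_eq_aRx_mul θ, model_eq_aRx_mul (stepARx Y θ), sub_mul]
  rfl

lemma modelDist_stepH_le :
    modelDist θ (stepH Y θ) ≤ cost Y θ - cost Y (stepH Y θ) := by
  refine modelDist_le_cost_sub (le_of_eq ?_)
  rw [sum_eq_sum_h]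
  refine (Finset.sum_eq_zero fun p _ => Finset.sum_eq_zero fun t _ => ?_).symm
  have h := congrArg (fun z => (star (newH Y θ p t - θ.h p t) * z).re) (gradH_stepH Y θ p t)
  simp only [gradH, Finset.mul_sum, mul_zero, Complex.zero_re, Complex.re_sum] at h
  rw [← h]
  refine Finset.sum_congr rfl fun i _ => ?_
  rw [← mul_assoc, ← star_mul', model_eq_h_mul θ, model_eq_h_mul (stepH Y θ), sub_mul]
  rfl

variable {θ}

lemma modelDist_stepGTx_le [NeZero N] {ε : ℝ} (hc : ∀ p l, ‖θ.c p l‖ = 1)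
    (h0 : ∀ l, θ.gTx 0 l = 1) (hg : ∀ n l, n ≠ 0 → θ.gTx n l ∈ Set.Icc ε 1) :
    modelDist θ (stepGTx ε Y θ) ≤ cost Y θ - cost Y (stepGTx ε Y θ) := by
  refine modelDist_le_cost_sub ?_
  rw [sum_eq_sum_gTx]
  refine Finset.sum_nonneg fun n _ => Finset.sum_nonneg fun l _ => ?_
  have h : ∑ i : Fin P × Fin M × Fin T,
      (star ((stepGTx ε Y θ).model i.1 n i.2.1 l i.2.2 - θ.model i.1 n i.2.1 l i.2.2) *
        (Y i.1 n i.2.1 l i.2.2 - (stepGTx ε Y θ).model i.1 n i.2.1 l i.2.2)).re =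
      (((newGTx ε Y θ n l - θ.gTx n l : ℝ) : ℂ) * gradGTx Y (stepGTx ε Y θ) n l).re := by
    rw [gradGTx, Finset.mul_sum, Complex.re_sum]
    refine Finset.sum_congr rfl fun i _ => ?_
    rw [← mul_assoc, ← Complex.conj_ofReal, starRingEnd_apply, ← star_mul', model_eq_gTx_mul θ,
      model_eq_gTx_mul (stepGTx ε Y θ), Complex.ofReal_sub, sub_mul]
    rfl
  rw [h, Complex.re_ofReal_mul]
  by_cases hn : n = 0
  · have : newGTx ε Y θ n l - θ.gTx n l = 0 := by
      rw [hn, h0, newGTx, if_pos rfl, sub_self]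
    rw [this, zero_mul]
  · have := sub_mul_gradGTx_stepGTx_nonpos Y hc (hg n l hn) hn l
    change (θ.gTx n l - newGTx ε Y θ n l) * _ ≤ 0 at this
    linarith

lemma modelDist_stepGRx_le {ε : ℝ} (hc : ∀ p l, ‖θ.c p l‖ = 1)
    (hg : ∀ m l, θ.gRx m l ∈ Set.Icc ε 1) :
    modelDist θ (stepGRx ε Y θ) ≤ cost Y θ - cost Y (stepGRx ε Y θ) := by
  refine modelDist_le_cost_sub ?_
  rw [sum_eq_sum_gRx]
  refine Finset.sum_nonneg fun m _ => Finset.sum_nonneg fun l _ => ?_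
  have h : ∑ i : Fin P × Fin N × Fin T,
      (star ((stepGRx ε Y θ).model i.1 i.2.1 m l i.2.2 - θ.model i.1 i.2.1 m l i.2.2) *
        (Y i.1 i.2.1 m l i.2.2 - (stepGRx ε Y θ).model i.1 i.2.1 m l i.2.2)).re =
      (((newGRx ε Y θ m l - θ.gRx m l : ℝ) : ℂ) * gradGRx Y (stepGRx ε Y θ) m l).re := by
    rw [gradGRx, Finset.mul_sum, Complex.re_sum]
    refine Finset.sum_congr rfl fun i _ => ?_
    rw [← mul_assoc, ← Complex.conj_ofReal, starRingEnd_apply, ← star_mul', model_eq_gRx_mul θ,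
      model_eq_gRx_mul (stepGRx ε Y θ), Complex.ofReal_sub, sub_mul]
    rfl
  rw [h, Complex.re_ofReal_mul]
  have := sub_mul_gradGRx_stepGRx_nonpos Y hc (hg m l) m l
  change (θ.gRx m l - newGRx ε Y θ m l) * _ ≤ 0 at this
  linarith

/-- The phase update does not increase the cost. The change of the model need not be small here, as
the maximizing phase is not unique. -/
lemma cost_stepC_le (hc : ∀ p l, ‖θ.c p l‖ = 1) : cost Y (stepC Y θ) ≤ cost Y θ := by
  have expand : ∀ θ' : Params P N M L T, (∀ p l, ‖θ'.c p l‖ = 1) → cost Y θ' =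
      ∑ p, ∑ l, ((∑ i : Fin N × Fin M × Fin T,
        (‖Y p i.1 i.2.1 l i.2.2‖ ^ 2 + ‖θ'.regC p l i‖ ^ 2)) - 2 * (star (θ'.c p l) *
        ∑ i : Fin N × Fin M × Fin T, star (θ'.regC p l i) * Y p i.1 i.2.1 l i.2.2).re) := by
    intro θ' hc'
    rw [cost, sum_eq_sum_c]
    refine Finset.sum_congr rfl fun p _ => Finset.sum_congr rfl fun l _ => ?_
    rw [Finset.mul_sum, Complex.re_sum, Finset.mul_sum, ← Finset.sum_sub_distrib]
    refine Finset.sum_congr rfl fun i _ => ?_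
    have h1 : ‖θ'.regC p l i‖ = ‖θ'.model p i.1 i.2.1 l i.2.2‖ := by
      rw [model_eq_c_mul, norm_mul, hc', one_mul]
    rw [← mul_assoc, ← star_mul', ← model_eq_c_mul, h1]
    simp only [← Complex.normSq_eq_norm_sq, Complex.normSq_apply, Complex.star_def, Complex.mul_re,
      Complex.sub_re, Complex.sub_im, Complex.conj_re, Complex.conj_im]
    ring
  rw [expand θ hc, expand (stepC Y θ) (norm_newC Y θ)]
  refine Finset.sum_le_sum fun p _ => Finset.sum_le_sum fun l _ => ?_
  have h1 := star_newC_mul Y θ p l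
  have h2 : (star (θ.c p l) *
      ∑ i : Fin N × Fin M × Fin T, star (θ.regC p l i) * Y p i.1 i.2.1 l i.2.2).re ≤
      ‖∑ i : Fin N × Fin M × Fin T, star (θ.regC p l i) * Y p i.1 i.2.1 l i.2.2‖ := by
    refine (Complex.re_le_norm _).trans ?_
    rw [norm_mul, norm_star, hc, one_mul]
  have h3 : (star ((stepC Y θ).c p l) * ∑ i : Fin N × Fin M × Fin T,
      star ((stepC Y θ).regC p l i) * Y p i.1 i.2.1 l i.2.2).re =
      ‖∑ i : Fin N × Fin M × Fin T, star (θ.regC p l i) * Y p i.1 i.2.1 l i.2.2‖ :=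
    congrArg Complex.re h1
  rw [h3]
  have h4 : ∀ i, (stepC Y θ).regC p l i = θ.regC p l i := fun _ => rfl
  simp only [h4]
  linarith

end

/-! ### First-order conditions -/

section Cone

variable {E : Type*} [NormedAddCommGroup E] [NormedSpace ℝ E] {f : E → ℝ} {S : Set E} {a d : E}

lemma lineDeriv_nonpos_of_mem_posTangentConeAt {v : ℝ} (hf : DifferentiableAt ℝ f a)
    (hmax : ∀ x ∈ S, f x ≤ f a) (hd : d ∈ posTangentConeAt S a) (hv : HasLineDerivAt ℝ f v a d) :
    v ≤ 0 := by
  rw [hv.unique (hf.hasFDerivAt.hasLineDerivAt d)]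
  exact IsLocalMaxOn.hasFDerivWithinAt_nonpos
    (eventually_nhdsWithin_of_forall hmax) hf.hasFDerivAt.hasFDerivWithinAt hd

lemma lineDeriv_eq_zero_of_mem_posTangentConeAt {v : ℝ} (hf : DifferentiableAt ℝ f a)
    (hconst : ∀ x ∈ S, f x = f a) (hd : d ∈ posTangentConeAt S a)
    (hv : HasLineDerivAt ℝ f v a d) : v = 0 := by
  refine le_antisymm
    (lineDeriv_nonpos_of_mem_posTangentConeAt hf (fun x hx => (hconst x hx).le) hd hv) ?_
  have hv' : HasLineDerivAt ℝ (fun x => -f x) (-v) a d := HasDerivAt.fun_neg hv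
  have := lineDeriv_nonpos_of_mem_posTangentConeAt hf.fun_neg
    (fun x hx => neg_le_neg (hconst x hx).ge) hd hv'
  linarith

end Cone

section

variable {P N M L T : ℕ} (Y : Data P N M L T)

lemma differentiable_model (p : Fin P) (n : Fin N) (m : Fin M) (l : Fin L) (t : Fin T) :
    Differentiable ℝ fun θ : Params P N M L T => θ.model p n m l t := by
  have h1 : Differentiable ℝ fun θ : Params P N M L T => ((θ.gTx n l : ℝ) : ℂ) :=
    Complex.ofRealCLM.differentiable.comp (by fun_prop)
  have h2 : Differentiable ℝ fun θ : Params P N M L T => ((θ.gRx m l : ℝ) : ℂ) :=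
    Complex.ofRealCLM.differentiable.comp (by fun_prop)
  unfold Params.model Params.b
  exact (((by fun_prop : Differentiable ℝ fun θ : Params P N M L T => θ.aTx p n).mul
    (by fun_prop)).mul ((h1.mul h2).mul (by fun_prop))).mul (by fun_prop)

lemma differentiable_cost : Differentiable ℝ (cost Y) := by
  have h := differentiable_model (P := P) (N := N) (M := M) (L := L) (T := T)
  unfold cost
  exact Differentiable.fun_sum fun p _ => Differentiable.fun_sum fun n _ =>
    Differentiable.fun_sum fun m _ => Differentiable.fun_sum fun l _ =>
    Differentiable.fun_sum fun t _ => ((h p n m l t).const_sub _).norm_sq ℝ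

/-- Directional derivative of a model entry: the Leibniz rule over the six blocks. -/
lemma hasLineDerivAt_model (θ d : Params P N M L T) (p : Fin P) (n : Fin N) (m : Fin M) (l : Fin L)
    (t : Fin T) : HasLineDerivAt ℝ (fun θ : Params P N M L T => θ.model p n m l t)
      (d.aTx p n * θ.regATx p n (m, l, t) + d.aRx p m * θ.regARx p m (n, l, t) +
        d.c p l * θ.regC p l (n, m, t) + d.gTx n l * θ.regGTx n l (p, m, t) +
        d.gRx m l * θ.regGRx m l (p, n, t) + d.h p t * θ.regH p (n, m, l)) θ d := by
  have aff : ∀ x y : ℂ, HasDerivAt (fun s : ℝ => x + s * y) y 0 := fun x y => by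
    simpa using ((Complex.ofRealCLM.hasDerivAt (x := (0 : ℝ))).mul_const y).const_add x
  have key := (((aff (θ.aTx p n) (d.aTx p n)).mul (aff (θ.aRx p m) (d.aRx p m))).mul
    (((aff (θ.gTx n l) (d.gTx n l)).mul (aff (θ.gRx m l) (d.gRx m l))).mul
      (aff (θ.c p l) (d.c p l)))).mul (aff (θ.h p t) (d.h p t))
  refine (key.congr_deriv ?_).congr_of_eventuallyEq (Eventually.of_forall fun s => ?_)
  · simp only [Params.regATx, Params.regARx, Params.regC, Params.regGTx, Params.regGRx,
      Params.regH, Params.b, Complex.ofReal_zero, zero_mul, add_zero, Pi.mul_apply]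
    ring
  · change (θ.aTx p n + s • d.aTx p n) * (θ.aRx p m + s • d.aRx p m) *
      (((θ.gTx n l + s • d.gTx n l : ℝ) : ℂ) * ((θ.gRx m l + s • d.gRx m l : ℝ) : ℂ) *
        (θ.c p l + s • d.c p l)) * (θ.h p t + s • d.h p t) = _
    simp

lemma hasLineDerivAt_cost (θ d : Params P N M L T) :
    HasLineDerivAt ℝ (cost Y) (-2 *
      (∑ p, ∑ n, (star (d.aTx p n) * gradATx Y θ p n).re +
        ∑ p, ∑ m, (star (d.aRx p m) * gradARx Y θ p m).re +
        ∑ p, ∑ l, (star (d.c p l) * gradC Y θ p l).re +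
        ∑ n, ∑ l, d.gTx n l * (gradGTx Y θ n l).re +
        ∑ m, ∑ l, d.gRx m l * (gradGRx Y θ m l).re +
        ∑ p, ∑ t, (star (d.h p t) * gradH Y θ p t).re)) θ d := by
  have key : HasLineDerivAt ℝ (cost Y) (∑ p, ∑ n, ∑ m, ∑ l, ∑ t,
      2 * inner ℝ (Y p n m l t - θ.model p n m l t)
        (-(d.aTx p n * θ.regATx p n (m, l, t) + d.aRx p m * θ.regARx p m (n, l, t) +
          d.c p l * θ.regC p l (n, m, t) + d.gTx n l * θ.regGTx n l (p, m, t) +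
          d.gRx m l * θ.regGRx m l (p, n, t) + d.h p t * θ.regH p (n, m, l)))) θ d := by
    unfold HasLineDerivAt cost
    refine HasDerivAt.fun_sum fun p _ => HasDerivAt.fun_sum fun n _ => HasDerivAt.fun_sum fun m _ =>
      HasDerivAt.fun_sum fun l _ => HasDerivAt.fun_sum fun t _ => ?_
    have h : HasDerivAt (fun s : ℝ => (θ + s • d).model p n m l t) _ 0 :=
      hasLineDerivAt_model θ d p n m l t
    simpa using (h.const_sub (Y p n m l t)).norm_sq
  convert key using 1
  simp only [gradATx, gradARx, gradC, gradGTx, gradGRx, gradH, Finset.mul_sum, Complex.re_sum]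
  rw [← sum_eq_sum_aTx fun p n m l t => (star (d.aTx p n) *
      (star (θ.regATx p n (m, l, t)) * (Y p n m l t - θ.model p n m l t))).re,
    ← sum_eq_sum_aRx fun p n m l t => (star (d.aRx p m) *
      (star (θ.regARx p m (n, l, t)) * (Y p n m l t - θ.model p n m l t))).re,
    ← sum_eq_sum_c fun p n m l t => (star (d.c p l) *
      (star (θ.regC p l (n, m, t)) * (Y p n m l t - θ.model p n m l t))).re,
    ← sum_eq_sum_gTx fun p n m l t => d.gTx n l *
      (star (θ.regGTx n l (p, m, t)) * (Y p n m l t - θ.model p n m l t)).re,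
    ← sum_eq_sum_gRx fun p n m l t => d.gRx m l *
      (star (θ.regGRx m l (p, n, t)) * (Y p n m l t - θ.model p n m l t)).re,
    ← sum_eq_sum_h fun p n m l t => (star (d.h p t) *
      (star (θ.regH p (n, m, l)) * (Y p n m l t - θ.model p n m l t))).re]
  simp only [← Finset.sum_add_distrib, Finset.mul_sum]
  refine Finset.sum_congr rfl fun p _ => Finset.sum_congr rfl fun n _ =>
    Finset.sum_congr rfl fun m _ => Finset.sum_congr rfl fun l _ =>
    Finset.sum_congr rfl fun t _ => ?_
  simp only [Complex.inner, Complex.star_def, Complex.mul_re, Complex.mul_im, Complex.add_re,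
    Complex.add_im, Complex.neg_re, Complex.neg_im, Complex.conj_re, Complex.conj_im,
    Complex.ofReal_re, Complex.ofReal_im]
  ring

variable {Y} {θ : Params P N M L T} {ε : ℝ}

/-- Blockwise first-order conditions imply stationarity on the relaxed set. The conditions on the
phases and on the magnitude responses are expressed by the model tensor. -/
lemma isStationaryPointOn_relaxedSet [NeZero N] (hε : 0 < ε) (hθ : θ ∈ relaxedSet ε)
    (haTx : ∀ p n, gradATx Y θ p n = 0) (haRx : ∀ p m, gradARx Y θ p m = 0)
    (hh : ∀ p t, gradH Y θ p t = 0) (hc : ∀ p l, (corrC Y θ.model p l).im = 0)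
    (hgTx : ∀ n, n ≠ 0 → ∀ l, ∀ x ∈ Set.Icc ε 1,
      (x - θ.gTx n l) * (corrGTx Y θ.model n l).re ≤ 0)
    (hgRx : ∀ m l, ∀ x ∈ Set.Icc ε 1, (x - θ.gRx m l) * (corrGRx Y θ.model m l).re ≤ 0) :
    IsStationaryPointOn (cost Y) (relaxedSet ε) θ := by
  obtain ⟨h1, h2, h3, h4⟩ := hθ
  refine ⟨⟨h1, h2, h3, h4⟩, differentiable_cost Y θ, fun d hd => ?_⟩
  have hline := (differentiable_cost Y θ).hasFDerivAt.hasLineDerivAt d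
  rw [hline.unique (hasLineDerivAt_cost Y θ d)]
  have line : ∀ x y : ℝ, HasDerivAt (fun s : ℝ => x + s * y) y 0 := fun x y => by
    simpa using ((hasDerivAt_id (0 : ℝ)).mul_const y).const_add x
  -- On the product of circles the tangent directions are orthogonal to `c_p`.
  have tc : ∀ p l, (star (d.c p l) * gradC Y θ p l).re = 0 := by
    intro p l
    have hderiv : HasLineDerivAt ℝ (fun θ : Params P N M L T => ‖θ.c p l‖ ^ 2)
        (2 * inner ℝ (θ.c p l) (d.c p l)) θ d := by
      have : HasDerivAt (fun s : ℝ => θ.c p l + s • d.c p l) (d.c p l) 0 := by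
        simpa using ((hasDerivAt_id (0 : ℝ)).smul_const (d.c p l)).const_add (θ.c p l)
      have h := this.norm_sq
      rw [zero_smul, add_zero] at h
      exact h
    have h0 := lineDeriv_eq_zero_of_mem_posTangentConeAt (S := relaxedSet ε)
      (((by fun_prop : Differentiable ℝ fun θ : Params P N M L T => θ.c p l).norm_sq ℝ) θ)
      (fun x hx => by rw [hx.1, h1]) hd hderiv
    have hz : gradC Y θ p l = (corrC Y θ.model p l).re * θ.c p l := by
      have hn : θ.c p l * star (θ.c p l) = 1 := by
        rw [Complex.star_def, Complex.mul_conj', h1]; simp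
      have hr : ((corrC Y θ.model p l).re : ℂ) = corrC Y θ.model p l :=
        Complex.ext (by simp) (by simp [hc])
      rw [hr, corrC_model, mul_right_comm, mul_comm (star _), hn, one_mul]
    rw [hz]
    have : (star (d.c p l) * ((corrC Y θ.model p l).re * θ.c p l)).re =
        (corrC Y θ.model p l).re * inner ℝ (θ.c p l) (d.c p l) := by
      simp only [Complex.inner, Complex.star_def, Complex.mul_re, Complex.mul_im, Complex.conj_re,
        Complex.conj_im, Complex.ofReal_re, Complex.ofReal_im]
      ring
    rw [this, (by linarith : inner ℝ (θ.c p l) (d.c p l) = 0), mul_zero]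
  have tgTx : ∀ n l, d.gTx n l * (gradGTx Y θ n l).re ≤ 0 := by
    intro n l
    have hderiv : ∀ w : ℝ, HasLineDerivAt ℝ (fun θ : Params P N M L T => θ.gTx n l * w)
        (d.gTx n l * w) θ d :=
      fun w => (line (θ.gTx n l) (d.gTx n l)).mul_const w
    by_cases hn : n = 0
    · have := lineDeriv_eq_zero_of_mem_posTangentConeAt (S := relaxedSet ε)
        (by fun_prop) (fun x hx => by rw [hn, hx.2.1, h2]) hd (hderiv (gradGTx Y θ n l).re)
      exact this.le
    · refine lineDeriv_nonpos_of_mem_posTangentConeAt (S := relaxedSet ε)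
        (by fun_prop) (fun x hx => ?_) hd (hderiv (gradGTx Y θ n l).re)
      have := hgTx n hn l _ (hx.2.2.1 n l hn)
      rw [corrGTx_model, Complex.re_ofReal_mul, mul_left_comm] at this
      have := nonpos_of_mul_nonpos_right this (hε.trans_le (h3 n l hn).1)
      linarith
  have tgRx : ∀ m l, d.gRx m l * (gradGRx Y θ m l).re ≤ 0 := by
    intro m l
    have hderiv : HasLineDerivAt ℝ
        (fun x : Params P N M L T => x.gRx m l * (gradGRx Y θ m l).re)
        (d.gRx m l * (gradGRx Y θ m l).re) θ d :=
      (line (θ.gRx m l) (d.gRx m l)).mul_const (gradGRx Y θ m l).re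
    refine lineDeriv_nonpos_of_mem_posTangentConeAt (S := relaxedSet ε)
      (by fun_prop) (fun x hx => ?_) hd hderiv
    have := hgRx m l _ (hx.2.2.2 m l)
    rw [corrGRx_model, Complex.re_ofReal_mul, mul_left_comm] at this
    have := nonpos_of_mul_nonpos_right this (hε.trans_le (h4 m l).1)
    linarith
  have sTx := Finset.sum_nonpos fun n (_ : n ∈ Finset.univ) =>
    Finset.sum_nonpos fun l (_ : l ∈ Finset.univ) => tgTx n l
  have sRx := Finset.sum_nonpos fun m (_ : m ∈ Finset.univ) =>
    Finset.sum_nonpos fun l (_ : l ∈ Finset.univ) => tgRx m l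
  simp only [haTx, haRx, hh, tc, mul_zero, Complex.zero_re, Finset.sum_const_zero]
  linarith

end

section

variable {P N M L T : ℕ} {ε : ℝ}

/-! ### Feasible points and rescaling -/

lemma iSup_mem_Icc [NeZero L] {g : Fin L → ℝ} (hg : ∀ l, g l ∈ Set.Icc ε 1) :
    ⨆ l, g l ∈ Set.Icc ε 1 :=
  ⟨(hg 0).1.trans (le_ciSup (Set.finite_range g).bddAbove 0), ciSup_le fun l => (hg l).2⟩

lemma continuous_iSup_fin [NeZero L] : Continuous fun g : Fin L → ℝ => ⨆ l, g l := by
  simp only [← Finset.sup'_univ_eq_ciSup]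
  exact Continuous.finset_sup'_apply _ fun l _ => continuous_apply l

lemma feasibleSet_subset_relaxedSet [NeZero N] [NeZero M] [NeZero L] :
    (feasibleSet ε : Set (Params P N M L T)) ⊆ relaxedSet ε := by
  rintro θ ⟨-, -, -, -, h5, h6, h7, h8, h9, h10, h11⟩
  refine ⟨fun p l => ?_, h7, fun n l hn => ⟨h8 n l hn, ?_⟩, fun m l => ⟨h10 m l, ?_⟩⟩
  · by_cases hl : l = 0
    · rw [hl, h5, norm_one]
    · exact h6 p l hl
  · rw [← h9 n hn]
    exact le_ciSup (Set.finite_range _).bddAbove l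
  · rw [← h11 m]
    exact le_ciSup (Set.finite_range _).bddAbove l

lemma isClosed_feasibleSet [NeZero N] [NeZero M] [NeZero L] :
    IsClosed (feasibleSet ε : Set (Params P N M L T)) := by
  have hs := continuous_iSup_fin (L := L)
  simp only [feasibleSet, Set.ofPred_and, Set.ofPred_forall]
  refine IsClosed.inter (isClosed_iInter fun p => isClosed_eq ?_ continuous_const) <|
    IsClosed.inter (isClosed_iInter fun p => isClosed_eq ?_ continuous_const) <|
    IsClosed.inter (isClosed_iInter fun p => isClosed_eq ?_ continuous_const) <|
    IsClosed.inter (isClosed_iInter fun p => isClosed_eq ?_ continuous_const) <|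
    IsClosed.inter (isClosed_iInter fun p => isClosed_eq ?_ continuous_const) <|
    IsClosed.inter (isClosed_iInter fun p => isClosed_iInter fun l => isClosed_iInter fun _ =>
      isClosed_eq ?_ continuous_const) <|
    IsClosed.inter (isClosed_iInter fun l => isClosed_eq ?_ continuous_const) <|
    IsClosed.inter (isClosed_iInter fun n => isClosed_iInter fun l => isClosed_iInter fun _ =>
      isClosed_le continuous_const ?_) <|
    IsClosed.inter (isClosed_iInter fun n => isClosed_iInter fun _ =>
      isClosed_eq (hs.comp (g := fun g : Fin L → ℝ => ⨆ l, g l) ?_) continuous_const) <|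
    IsClosed.inter (isClosed_iInter fun m => isClosed_iInter fun l =>
      isClosed_le continuous_const ?_) <|
    isClosed_iInter fun m =>
      isClosed_eq (hs.comp (g := fun g : Fin L → ℝ => ⨆ l, g l) ?_) continuous_const
  all_goals first | exact Complex.continuous_im.comp (by fun_prop) | fun_prop

lemma kappaGTx_pos [NeZero N] [NeZero L] (hε : 0 < ε) {φ : Params P N M L T}
    (hφ : φ ∈ relaxedSet ε) (n : Fin N) : 0 < kappaGTx φ n := by
  unfold kappaGTx
  split_ifs with hn
  · exact one_pos
  · exact inv_pos.2 (hε.trans_le (iSup_mem_Icc fun l => hφ.2.2.1 n l hn).1)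

lemma kappaGRx_pos [NeZero N] [NeZero L] (hε : 0 < ε) {φ : Params P N M L T}
    (hφ : φ ∈ relaxedSet ε) (m : Fin M) : 0 < kappaGRx φ m :=
  inv_pos.2 (hε.trans_le (iSup_mem_Icc fun l => hφ.2.2.2 m l).1)

lemma le_inv_iSup_mul [NeZero L] (hε : 0 < ε) {g : Fin L → ℝ} (hg : ∀ l, g l ∈ Set.Icc ε 1)
    (l : Fin L) : ε ≤ (⨆ l, g l)⁻¹ * g l := by
  have h := iSup_mem_Icc hg
  have h1 : 1 ≤ (⨆ l, g l)⁻¹ := (one_le_inv₀ (hε.trans_le h.1)).2 h.2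
  nlinarith [(hg l).1]

lemma iSup_inv_iSup_mul [NeZero L] (hε : 0 < ε) {g : Fin L → ℝ} (hg : ∀ l, g l ∈ Set.Icc ε 1) :
    ⨆ l, (⨆ l, g l)⁻¹ * g l = 1 := by
  have h := hε.trans_le (iSup_mem_Icc hg).1
  rw [← Real.mul_iSup_of_nonneg (inv_nonneg.2 h.le), inv_mul_cancel₀ h.ne']

lemma mem_feasibleSet_of_isRescaling [NeZero N] [NeZero M] [NeZero L] (hε : 0 < ε)
    {φ θ : Params P N M L T} (hφ : φ ∈ relaxedSet ε) (h : IsRescaling φ θ) :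
    θ ∈ feasibleSet ε := by
  obtain ⟨κTx, κRx, -, -, h3, h4, h5, h6, hc, hgTx, hgRx, -⟩ := h
  obtain ⟨c1, g0, gT, gR⟩ := hφ
  refine ⟨h3, h4, h5, h6, fun p => ?_, fun p l _ => ?_, fun l => ?_, fun n l hn => ?_,
    fun n hn => ?_, fun m l => ?_, fun m => ?_⟩
  · rw [hc, Complex.star_def, Complex.conj_mul', c1]; simp
  · rw [hc, norm_mul, norm_star, c1, c1, one_mul]
  · rw [hgTx, g0, kappaGTx, if_pos rfl, one_mul]
  · rw [hgTx, kappaGTx, if_neg hn]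
    exact le_inv_iSup_mul hε (fun l => gT n l hn) l
  · simp only [hgTx, kappaGTx, if_neg hn]
    exact iSup_inv_iSup_mul hε (fun l => gT n l hn)
  · rw [hgRx]
    exact le_inv_iSup_mul hε (gR m) l
  · simp only [hgRx]
    exact iSup_inv_iSup_mul hε (gR m)

/-- Under a rescaling the gains are divided by the factor by which their regressors are
multiplied. -/
lemma exists_regH_of_isRescaling [NeZero N] [NeZero M] [NeZero L] (hε : 0 < ε)
    {φ θ : Params P N M L T} (hφ : φ ∈ relaxedSet ε) (h : IsRescaling φ θ) :
    ∃ s : Fin P → ℂ, (∀ p, s p ≠ 0) ∧ (∀ p i, θ.regH p i = s p * φ.regH p i) ∧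
      ∀ p t, θ.h p t = (s p)⁻¹ * φ.h p t := by
  obtain ⟨κTx, κRx, haTx, haRx, -, h4, -, h6, hc, hgTx, hgRx, hh⟩ := h
  refine ⟨fun p => κTx p * κRx p * star (φ.c p 0), fun p => ?_, fun p i => ?_, hh⟩
  · refine mul_ne_zero (mul_ne_zero ?_ ?_) ?_
    · intro h0
      have := h4 p
      simp only [haTx, h0, zero_mul, norm_zero] at this
      simp at this
      exact NeZero.ne N (by exact_mod_cast this.symm)
    · intro h0
      have := h6 p
      simp only [haRx, h0, zero_mul, norm_zero] at this
      simp at this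
      exact NeZero.ne M (by exact_mod_cast this.symm)
    · rw [← norm_ne_zero_iff, norm_star, hφ.1]
      exact one_ne_zero
  · have k1 : (kappaGTx φ i.1 : ℂ) ≠ 0 := by exact_mod_cast (kappaGTx_pos hε hφ i.1).ne'
    have k2 : (kappaGRx φ i.2.1 : ℂ) ≠ 0 := by exact_mod_cast (kappaGRx_pos hε hφ i.2.1).ne'
    simp only [Params.regH, Params.b, haTx, haRx, hc, hgTx, hgRx, Complex.ofReal_mul]
    field_simp

lemma model_eq_of_isRescaling [NeZero N] [NeZero M] [NeZero L] (hε : 0 < ε)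
    {φ θ : Params P N M L T} (hφ : φ ∈ relaxedSet ε) (h : IsRescaling φ θ) :
    θ.model = φ.model := by
  obtain ⟨s, hs, hreg, hh⟩ := exists_regH_of_isRescaling hε hφ h
  funext p n m l t
  have := hs p
  rw [model_eq_h_mul θ p t (n, m, l), model_eq_h_mul φ p t (n, m, l), hreg, hh]
  field_simp

variable (Y : Data P N M L T)

lemma gradH_eq_zero_of_isRescaling [NeZero N] [NeZero M] [NeZero L] (hε : 0 < ε)
    {φ θ : Params P N M L T} (hφ : φ ∈ relaxedSet ε) (h : IsRescaling φ θ) (p : Fin P) (t : Fin T)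
    (h0 : gradH Y φ p t = 0) : gradH Y θ p t = 0 := by
  obtain ⟨s, -, hreg, -⟩ := exists_regH_of_isRescaling hε hφ h
  have : gradH Y θ p t = star (s p) * gradH Y φ p t := by
    simp only [gradH, hreg, model_eq_of_isRescaling hε hφ h, star_mul', Finset.mul_sum, mul_assoc]
  rw [this, h0, mul_zero]

/-! ### One iteration -/

/-- The point after the updates of the steering vectors and the phases. -/
def afterC (θ : Params P N M L T) : Params P N M L T :=
  stepC Y (stepARx Y (stepATx Y θ))

lemma sweep_mem_relaxedSet [NeZero N] (hε1 : ε ≤ 1) (θ : Params P N M L T) :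
    sweep ε Y θ ∈ relaxedSet ε := by
  refine ⟨norm_newC Y _, fun l => ?_, fun n l hn => ?_, fun m l => clip_mem_Icc hε1 _⟩
  · change newGTx ε Y (afterC Y θ) 0 l = 1
    exact if_pos rfl
  · change newGTx ε Y _ n l ∈ _
    rw [newGTx, if_neg hn]
    exact clip_mem_Icc hε1 _

/-- In one iteration from a point of the relaxed set, the squared distances between consecutive
models, the phase update excepted, add up to at most the decrease of the cost. -/
lemma sum_modelDist_le [NeZero N] [NeZero M] [NeZero L] (hε : 0 < ε) (hε1 : ε ≤ 1)
    {θ θ' : Params P N M L T} (hθ : θ ∈ relaxedSet ε) (h : IsRescaling (sweep ε Y θ) θ') :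
    modelDist θ (stepATx Y θ) + modelDist (stepATx Y θ) (stepARx Y (stepATx Y θ)) +
      modelDist (afterC Y θ) (stepGTx ε Y (afterC Y θ)) +
      modelDist (stepGTx ε Y (afterC Y θ)) (stepGRx ε Y (stepGTx ε Y (afterC Y θ))) +
      modelDist (stepGRx ε Y (stepGTx ε Y (afterC Y θ))) (sweep ε Y θ) ≤
      cost Y θ - cost Y θ' := by
  obtain ⟨h1, h2, h3, h4⟩ := hθ
  have hcost : cost Y θ' = cost Y (sweep ε Y θ) := by
    simp only [cost, model_eq_of_isRescaling hε (sweep_mem_relaxedSet Y hε1 θ) h]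
  have e1 := modelDist_stepATx_le Y θ
  have e2 := modelDist_stepARx_le Y (stepATx Y θ)
  have e3 : cost Y (afterC Y θ) ≤ _ := cost_stepC_le Y (θ := stepARx Y (stepATx Y θ)) h1
  have hc : ∀ p l, ‖(afterC Y θ).c p l‖ = 1 := norm_newC Y _
  have e4 := modelDist_stepGTx_le Y (θ := afterC Y θ) hc h2 h3
  have e5 := modelDist_stepGRx_le Y (θ := stepGTx ε Y (afterC Y θ)) hc h4
  have e6 : modelDist _ (sweep ε Y θ) ≤ _ - cost Y (sweep ε Y θ) :=
    modelDist_stepH_le Y (stepGRx ε Y (stepGTx ε Y (afterC Y θ)))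
  linarith

/-! ### Passage to the limit -/

section Limits

variable {ι : Type*} {F : Filter ι}

lemma tendsto_model_of_tendsto_model {a b : ι → Params P N M L T} {X : Data P N M L T}
    (ha : Tendsto (fun i => (a i).model) F (𝓝 X))
    (hab : Tendsto (fun i => modelDist (a i) (b i)) F (𝓝 0)) :
    Tendsto (fun i => (b i).model) F (𝓝 X) := by
  simp only [tendsto_pi_nhds] at ha ⊢
  intro p n m l t
  have h : Tendsto (fun i => (b i).model p n m l t - (a i).model p n m l t) F (𝓝 0) := by
    rw [tendsto_zero_iff_norm_tendsto_zero]
    have hs := Real.continuous_sqrt.continuousAt.tendsto.comp hab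
    rw [Real.sqrt_zero] at hs
    exact squeeze_zero (fun _ => norm_nonneg _)
      (fun i => Real.le_sqrt_of_sq_le (norm_model_sub_sq_le (a i) (b i) p n m l t)) hs
  simpa using (ha p n m l t).add h

lemma modelDist_comm (θ θ' : Params P N M L T) : modelDist θ θ' = modelDist θ' θ := by
  simp only [modelDist, norm_sub_rev]

lemma continuous_model : Continuous fun θ : Params P N M L T => θ.model :=
  continuous_pi fun p => continuous_pi fun n => continuous_pi fun m => continuous_pi fun l =>
    continuous_pi fun t => (differentiable_model p n m l t).continuous

lemma continuous_corrC (p : Fin P) (l : Fin L) : Continuous fun X => corrC Y X p l := by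
  unfold corrC; fun_prop

lemma continuous_corrGTx (n : Fin N) (l : Fin L) : Continuous fun X => corrGTx Y X n l := by
  unfold corrGTx; fun_prop

lemma continuous_corrGRx (m : Fin M) (l : Fin L) : Continuous fun X => corrGRx Y X m l := by
  unfold corrGRx; fun_prop

/-- Dividing a vector `g` of magnitude responses by its maximum keeps the optimality conditions on
the box `[ε, 1]` if the components `q` of the scaled gradient add up to zero: a maximum below `1`
makes all components of `q` nonpositive, hence zero. -/
lemma sub_inv_iSup_mul_mul_nonpos [NeZero L] {g q : Fin L → ℝ} (hε1 : ε ≤ 1)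
    (hg : ∀ l, g l ∈ Set.Icc ε 1) (hvi : ∀ l, ∀ x ∈ Set.Icc ε 1, (x - g l) * q l ≤ 0)
    (hq : ∑ l, q l = 0) (l : Fin L) {x : ℝ} (hx : x ∈ Set.Icc ε 1) :
    (x - (⨆ l, g l)⁻¹ * g l) * q l ≤ 0 := by
  have hs := iSup_mem_Icc hg
  rcases hs.2.eq_or_lt with h | h
  · rw [h, inv_one, one_mul]
    exact hvi l x hx
  · have hq0 : ∀ l, q l ≤ 0 := fun l => by
      have hl : g l < 1 := (le_ciSup (Set.finite_range g).bddAbove l).trans_lt h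
      exact nonpos_of_mul_nonpos_right (hvi l 1 ⟨hε1, le_rfl⟩) (sub_pos.2 hl)
    rw [(Finset.sum_eq_zero_iff_of_nonpos fun l _ => hq0 l).1 hq l (Finset.mem_univ l), mul_zero]

/-- Limit version of `sub_inv_iSup_mul_mul_nonpos`. -/
lemma sub_mul_nonpos_of_tendsto [NeZero L] (U : Ultrafilter ℕ) (hε : 0 < ε) (hε1 : ε ≤ 1)
    {g Q : ℕ → Fin L → ℝ} {γ q : Fin L → ℝ} (hg : ∀ i l, g i l ∈ Set.Icc ε 1)
    (hvi : ∀ i l, ∀ x ∈ Set.Icc ε 1, (x - g i l) * Q i l ≤ 0)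
    (hγ : Tendsto (fun i l => (⨆ l, g i l)⁻¹ * g i l) U (𝓝 γ)) (hQ : Tendsto Q U (𝓝 q))
    (hq : ∑ l, q l = 0) (l : Fin L) {x : ℝ} (hx : x ∈ Set.Icc ε 1) :
    (x - γ l) * q l ≤ 0 := by
  have hK : IsCompact (Set.univ.pi fun _ : Fin L => Set.Icc ε 1) :=
    isCompact_univ_pi fun _ => isCompact_Icc
  obtain ⟨a, ha, hUa⟩ := hK.ultrafilter_le_nhds (U.map g)
    (le_principal_iff.2 (mem_map.2 (univ_mem' fun i l _ => hg i l)))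
  have hga : Tendsto g U (𝓝 a) := hUa
  have ha' : ∀ l, a l ∈ Set.Icc ε 1 := fun l => ha l trivial
  have hsup : Tendsto (fun i => (⨆ l, g i l)⁻¹) U (𝓝 (⨆ l, a l)⁻¹) :=
    ((continuous_iSup_fin.tendsto a).comp hga).inv₀
      (hε.trans_le (iSup_mem_Icc ha').1).ne'
  have hγa : ∀ l, γ l = (⨆ l, a l)⁻¹ * a l := fun l =>
    tendsto_nhds_unique ((tendsto_pi_nhds.1 hγ) l) (hsup.mul ((tendsto_pi_nhds.1 hga) l))
  rw [hγa]
  refine sub_inv_iSup_mul_mul_nonpos hε1 ha' (fun l x hx => ?_) hq l hx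
  exact le_of_tendsto ((tendsto_const_nhds.sub ((tendsto_pi_nhds.1 hga) l)).mul
    ((tendsto_pi_nhds.1 hQ) l)) (Eventually.of_forall fun i => hvi i l x hx)

end Limits

end

section

variable {P N M L T : ℕ} {ε : ℝ} (Y : Data P N M L T)

/-- Optimality condition of the transmit magnitude update, multiplied by the positive updated
entry, which turns the partial gradient into a function of the model. -/
lemma sub_mul_re_corrGTx_nonpos [NeZero N] (hε : 0 < ε) (hε1 : ε ≤ 1) (θ : Params P N M L T)
    {n : Fin N} (hn : n ≠ 0) (l : Fin L) {x : ℝ} (hx : x ∈ Set.Icc ε 1) :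
    (x - (sweep ε Y θ).gTx n l) *
      (corrGTx Y (stepGTx ε Y (afterC Y θ)).model n l).re ≤ 0 := by
  have h := sub_mul_gradGTx_stepGTx_nonpos Y (θ := afterC Y θ) (norm_newC Y _) hx hn l
  have hg : 0 < (stepGTx ε Y (afterC Y θ)).gTx n l :=
    hε.trans_le ((sweep_mem_relaxedSet Y hε1 θ).2.2.1 n l hn).1
  rw [corrGTx_model, Complex.re_ofReal_mul, mul_left_comm]
  exact mul_nonpos_of_nonneg_of_nonpos hg.le h

/-- Optimality condition of the receive magnitude update, multiplied by the positive updated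
entry. -/
lemma sub_mul_re_corrGRx_nonpos [NeZero N] (hε : 0 < ε) (hε1 : ε ≤ 1) (θ : Params P N M L T)
    (m : Fin M) (l : Fin L) {x : ℝ} (hx : x ∈ Set.Icc ε 1) :
    (x - (sweep ε Y θ).gRx m l) *
      (corrGRx Y (stepGRx ε Y (stepGTx ε Y (afterC Y θ))).model m l).re ≤ 0 := by
  have h := sub_mul_gradGRx_stepGRx_nonpos Y (θ := stepGTx ε Y (afterC Y θ)) (norm_newC Y _) hx m l
  have hg : 0 < (stepGRx ε Y (stepGTx ε Y (afterC Y θ))).gRx m l :=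
    hε.trans_le ((sweep_mem_relaxedSet Y hε1 θ).2.2.2 m l).1
  rw [corrGRx_model, Complex.re_ofReal_mul, mul_left_comm]
  exact mul_nonpos_of_nonneg_of_nonpos hg.le h

section Limits

/-! ### First-order conditions at limit points -/

variable {ι : Type*} {F : Filter ι} {Y} {θ : ι → Params P N M L T}
  {θbar : Params P N M L T}

/-- Where the gain of the limit does not vanish, the convergence of the models forces the updated
transmit steering vectors to converge as well. -/
lemma tendsto_newATx (hθ : Tendsto θ F (𝓝 θbar))
    (h1 : Tendsto (fun i => (stepATx Y (θ i)).model) F (𝓝 θbar.model)) {p : Fin P} {n : Fin N}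
    {i : Fin M × Fin L × Fin T} (hreg : θbar.regATx p n i ≠ 0) :
    Tendsto (fun k => newATx Y (θ k) p n) F (𝓝 (θbar.aTx p n)) := by
  have hc : Continuous fun θ : Params P N M L T => θ.regATx p n i := by
    unfold Params.regATx Params.b
    fun_prop
  have hr := (hc.tendsto θbar).comp hθ
  have hm := tendsto_pi_nhds.1 (tendsto_pi_nhds.1 (tendsto_pi_nhds.1 (tendsto_pi_nhds.1
    (tendsto_pi_nhds.1 h1 p) n) i.1) i.2.1) i.2.2
  have hdiv := hm.div hr hreg
  rw [model_eq_aTx_mul, mul_div_cancel_right₀ _ hreg] at hdiv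
  refine hdiv.congr' ?_
  filter_upwards [hr.eventually_ne hreg] with k hk
  change (stepATx Y (θ k)).model p n i.1 i.2.1 i.2.2 / (stepATx Y (θ k)).regATx p n i = _
  rw [model_eq_aTx_mul]
  exact mul_div_cancel_right₀ _ hk

variable [F.NeBot]

lemma gradH_eq_zero_of_tendsto (hθ : Tendsto θ F (𝓝 θbar)) {p : Fin P} {t : Fin T}
    (h : ∀ᶠ i in F, gradH Y (θ i) p t = 0) : gradH Y θbar p t = 0 := by
  have hc : Continuous fun θ : Params P N M L T => gradH Y θ p t := by
    have := continuous_model (P := P) (N := N) (M := M) (L := L) (T := T)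
    unfold gradH Params.regH Params.b
    fun_prop
  exact tendsto_nhds_unique_of_eventuallyEq ((hc.tendsto θbar).comp hθ) tendsto_const_nhds h

lemma gradATx_eq_zero_of_tendsto (hθ : Tendsto θ F (𝓝 θbar))
    (h1 : Tendsto (fun i => (stepATx Y (θ i)).model) F (𝓝 θbar.model)) (p : Fin P) (n : Fin N) :
    gradATx Y θbar p n = 0 := by
  have hc : Continuous fun x : Params P N M L T × Data P N M L T =>
      ∑ i, star (x.1.regATx p n i) * (Y p n i.1 i.2.1 i.2.2 - x.2 p n i.1 i.2.1 i.2.2) := by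
    unfold Params.regATx Params.b
    fun_prop
  exact tendsto_nhds_unique_of_eventuallyEq
    ((hc.tendsto (θbar, θbar.model)).comp (hθ.prodMk_nhds h1)) tendsto_const_nhds
    (Eventually.of_forall fun i => gradATx_stepATx Y (θ i) p n)

lemma gradARx_eq_zero_of_tendsto [NeZero N] [NeZero M] [NeZero L] (hε : 0 < ε)
    (hbar : θbar ∈ feasibleSet ε) (hθ : Tendsto θ F (𝓝 θbar))
    (h1 : Tendsto (fun i => (stepATx Y (θ i)).model) F (𝓝 θbar.model))
    (h2 : Tendsto (fun i => (stepARx Y (stepATx Y (θ i))).model) F (𝓝 θbar.model))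
    (p : Fin P) (m : Fin M) : gradARx Y θbar p m = 0 := by
  by_cases hh : ∀ t, θbar.h p t = 0
  · simp [gradARx, Params.regARx, hh]
  push Not at hh
  obtain ⟨t, ht⟩ := hh
  obtain ⟨r1, r2, r3, r4⟩ := feasibleSet_subset_relaxedSet hbar
  obtain ⟨k, hk⟩ : ∃ k, θbar.aRx p k ≠ 0 := by
    by_contra! h0
    have := hbar.2.2.2.1 p
    simp only [h0, norm_zero] at this
    simp at this
    exact NeZero.ne M (by exact_mod_cast this.symm)
  have ha : Tendsto (fun i => newATx Y (θ i) p) F (𝓝 (θbar.aTx p)) := by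
    refine tendsto_pi_nhds.2 fun n => tendsto_newATx hθ h1 (i := (k, 0, t)) ?_
    have hg : θbar.gTx n 0 ≠ 0 := by
      by_cases hn : n = 0
      · rw [hn, r2]; exact one_ne_zero
      · exact (hε.trans_le (r3 n 0 hn).1).ne'
    have hg' : θbar.gRx k 0 ≠ 0 := (hε.trans_le (r4 k 0).1).ne'
    have hc : θbar.c p 0 ≠ 0 := norm_ne_zero_iff.1 (by rw [r1]; exact one_ne_zero)
    simp [Params.regATx, Params.b, hg, hg', hc, ht, hk]
  have hc : Continuous fun x : (Fin N → ℂ) × Params P N M L T × Data P N M L T =>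
      ∑ i : Fin N × Fin L × Fin T, star (x.1 i.1 * x.2.1.b i.1 m p i.2.1 * x.2.1.h p i.2.2) *
        (Y p i.1 m i.2.1 i.2.2 - x.2.2 p i.1 m i.2.1 i.2.2) := by
    unfold Params.b
    fun_prop
  exact tendsto_nhds_unique_of_eventuallyEq
    ((hc.tendsto (θbar.aTx p, θbar, θbar.model)).comp (ha.prodMk_nhds (hθ.prodMk_nhds h2)))
    tendsto_const_nhds (Eventually.of_forall fun i => gradARx_stepARx Y (stepATx Y (θ i)) p m)

end Limits

variable {Y}

lemma mem_feasibleSet_of_isModifiedBCD [NeZero N] [NeZero M] [NeZero L] (hε : 0 < ε) (hε1 : ε ≤ 1)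
    {θ : ℕ → Params P N M L T} (hθ : IsModifiedBCD ε Y θ) {i : ℕ} (hi : 1 ≤ i) :
    θ i ∈ feasibleSet ε := by
  obtain ⟨j, rfl⟩ := Nat.exists_eq_add_of_le' hi
  exact mem_feasibleSet_of_isRescaling hε (sweep_mem_relaxedSet Y hε1 _) (hθ j)

/-- The decrease of the cost in one iteration tends to zero, and with it everything that it
bounds. -/
lemma tendsto_zero_of_le_cost_sub [NeZero N] [NeZero M] [NeZero L] (hε : 0 < ε) (hε1 : ε ≤ 1)
    {θ : ℕ → Params P N M L T} (hθ : IsModifiedBCD ε Y θ) {u : ℕ → ℝ} (hu : ∀ i, 0 ≤ u i)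
    (hle : ∀ i, θ i ∈ relaxedSet ε → u i ≤ cost Y (θ i) - cost Y (θ (i + 1))) :
    Tendsto u atTop (𝓝 0) := by
  have hrel : ∀ i, 1 ≤ i → θ i ∈ relaxedSet ε := fun i hi =>
    feasibleSet_subset_relaxedSet (mem_feasibleSet_of_isModifiedBCD hε hε1 hθ hi)
  have hanti : Antitone fun i => cost Y (θ (i + 1)) := by
    refine antitone_nat_of_succ_le fun i => ?_
    have h := sum_modelDist_le Y hε hε1 (hrel (i + 1) (by omega)) (hθ (i + 1))
    refine sub_nonneg.1 (le_trans ?_ h)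
    have := @modelDist_nonneg P N M L T
    exact add_nonneg (add_nonneg (add_nonneg (add_nonneg (this _ _) (this _ _)) (this _ _))
      (this _ _)) (this _ _)
  have hbdd : BddBelow (Set.range fun i => cost Y (θ (i + 1))) :=
    ⟨0, by rintro _ ⟨i, rfl⟩; simp only [cost]; positivity⟩
  have hlim := tendsto_atTop_ciInf hanti hbdd
  have hdiff := hlim.sub ((tendsto_add_atTop_iff_nat 1).2 hlim)
  rw [sub_self] at hdiff
  rw [← tendsto_add_atTop_iff_nat 1]
  exact squeeze_zero (fun i => hu (i + 1)) (fun i => hle (i + 1) (hrel (i + 1) (by omega))) hdiff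

end

end Calibration

end

open Calibration in
theorem proposition1 {P N M L T : ℕ} [NeZero N] [NeZero M] [NeZero L]
    (ε : ℝ) (hε : 0 < ε) (hε1 : ε ≤ 1)
    (Y : Calibration.Data P N M L T)
    (θ : ℕ → Calibration.Params P N M L T) (hθ : Calibration.IsModifiedBCD ε Y θ)
    (θbar : Calibration.Params P N M L T) (hlim : MapClusterPt θbar atTop θ) :
    Calibration.IsStationaryPointOn (Calibration.cost Y) (Calibration.feasibleSet ε) θbar ∧
      Calibration.IsStationaryPointOn (Calibration.cost Y) (Calibration.relaxedSet ε) θbar := by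
  obtain ⟨U, hU, hθU⟩ := mapClusterPt_iff_ultrafilter.1 hlim
  have hfeas : ∀ᶠ i in (U : Filter ℕ), θ i ∈ feasibleSet ε :=
    hU ((eventually_ge_atTop 1).mono fun i hi => mem_feasibleSet_of_isModifiedBCD hε hε1 hθ hi)
  have hbar : θbar ∈ feasibleSet ε := isClosed_feasibleSet.mem_of_tendsto hθU hfeas
  have hstep : ∀ᶠ i in (U : Filter ℕ), IsRescaling (sweep ε Y (θ (i - 1))) (θ i) :=
    hU ((eventually_ge_atTop 1).mono fun i hi => by
      have := hθ (i - 1)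
      rwa [Nat.sub_add_cancel hi] at this)
  have hpred : Tendsto (fun i : ℕ => i - 1) U atTop := (tendsto_sub_atTop_nat 1).mono_left hU
  have hrel := fun i => sweep_mem_relaxedSet (ε := ε) Y hε1 (θ i)
  have nn := @modelDist_nonneg P N M L T
  have small : ∀ u : ℕ → ℝ, (∀ i, 0 ≤ u i) →
      (∀ i, θ i ∈ relaxedSet ε → u i ≤ cost Y (θ i) - cost Y (θ (i + 1))) →
      Tendsto u atTop (𝓝 0) := fun u => tendsto_zero_of_le_cost_sub hε hε1 hθ
  -- The models converge through the steering vector updates that follow `θ i`.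
  have hX : Tendsto (fun i => (θ i).model) U (𝓝 θbar.model) :=
    (continuous_model.tendsto θbar).comp hθU
  have hX1 : Tendsto (fun i => (stepATx Y (θ i)).model) U (𝓝 θbar.model) := by
    refine tendsto_model_of_tendsto_model hX
      ((small _ (fun i => nn _ _) fun i hi => ?_).mono_left hU)
    have := sum_modelDist_le Y hε hε1 hi (hθ i)
    linarith [nn (stepATx Y (θ i)) (stepARx Y (stepATx Y (θ i))),
      nn (afterC Y (θ i)) (stepGTx ε Y (afterC Y (θ i))),
      nn (stepGTx ε Y (afterC Y (θ i))) (stepGRx ε Y (stepGTx ε Y (afterC Y (θ i)))),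
      nn (stepGRx ε Y (stepGTx ε Y (afterC Y (θ i)))) (sweep ε Y (θ i))]
  have hX2 : Tendsto (fun i => (stepARx Y (stepATx Y (θ i))).model) U (𝓝 θbar.model) := by
    refine tendsto_model_of_tendsto_model hX1
      ((small _ (fun i => nn _ _) fun i hi => ?_).mono_left hU)
    have := sum_modelDist_le Y hε hε1 hi (hθ i)
    linarith [nn (θ i) (stepATx Y (θ i)),
      nn (afterC Y (θ i)) (stepGTx ε Y (afterC Y (θ i))),
      nn (stepGTx ε Y (afterC Y (θ i))) (stepGRx ε Y (stepGTx ε Y (afterC Y (θ i)))),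
      nn (stepGRx ε Y (stepGTx ε Y (afterC Y (θ i)))) (sweep ε Y (θ i))]
  -- They also converge through the updates after the phase update that leads to `θ i`.
  have hX6 : Tendsto (fun i => (sweep ε Y (θ (i - 1))).model) U (𝓝 θbar.model) :=
    hX.congr' (hstep.mono fun i hi => model_eq_of_isRescaling hε (hrel _) hi)
  have hX5 : Tendsto (fun i => (stepGRx ε Y (stepGTx ε Y (afterC Y (θ (i - 1))))).model) U
      (𝓝 θbar.model) := by
    refine tendsto_model_of_tendsto_model hX6
      ((small (fun i => modelDist (sweep ε Y (θ i)) (stepGRx ε Y (stepGTx ε Y (afterC Y (θ i)))))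
        (fun i => nn _ _) fun i hi => ?_).comp hpred)
    have := sum_modelDist_le Y hε hε1 hi (hθ i)
    rw [modelDist_comm]
    linarith [nn (θ i) (stepATx Y (θ i)), nn (stepATx Y (θ i)) (stepARx Y (stepATx Y (θ i))),
      nn (afterC Y (θ i)) (stepGTx ε Y (afterC Y (θ i))),
      nn (stepGTx ε Y (afterC Y (θ i))) (stepGRx ε Y (stepGTx ε Y (afterC Y (θ i))))]
  have hX4 : Tendsto (fun i => (stepGTx ε Y (afterC Y (θ (i - 1)))).model) U
      (𝓝 θbar.model) := by
    refine tendsto_model_of_tendsto_model hX5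
      ((small (fun i => modelDist (stepGRx ε Y (stepGTx ε Y (afterC Y (θ i))))
        (stepGTx ε Y (afterC Y (θ i)))) (fun i => nn _ _) fun i hi => ?_).comp hpred)
    have := sum_modelDist_le Y hε hε1 hi (hθ i)
    rw [modelDist_comm]
    linarith [nn (θ i) (stepATx Y (θ i)), nn (stepATx Y (θ i)) (stepARx Y (stepATx Y (θ i))),
      nn (afterC Y (θ i)) (stepGTx ε Y (afterC Y (θ i))),
      nn (stepGRx ε Y (stepGTx ε Y (afterC Y (θ i)))) (sweep ε Y (θ i))]
  have hX3 : Tendsto (fun i => (afterC Y (θ (i - 1))).model) U (𝓝 θbar.model) := by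
    refine tendsto_model_of_tendsto_model hX4
      ((small (fun i => modelDist (stepGTx ε Y (afterC Y (θ i))) (afterC Y (θ i)))
        (fun i => nn _ _) fun i hi => ?_).comp hpred)
    have := sum_modelDist_le Y hε hε1 hi (hθ i)
    rw [modelDist_comm]
    linarith [nn (θ i) (stepATx Y (θ i)), nn (stepATx Y (θ i)) (stepARx Y (stepATx Y (θ i))),
      nn (stepGTx ε Y (afterC Y (θ i))) (stepGRx ε Y (stepGTx ε Y (afterC Y (θ i)))),
      nn (stepGRx ε Y (stepGTx ε Y (afterC Y (θ i)))) (sweep ε Y (θ i))]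
  have haTx := gradATx_eq_zero_of_tendsto hθU hX1
  have haRx := gradARx_eq_zero_of_tendsto hε hbar hθU hX1 hX2
  have hstat : IsStationaryPointOn (cost Y) (relaxedSet ε) θbar := by
    refine isStationaryPointOn_relaxedSet hε (feasibleSet_subset_relaxedSet hbar) haTx haRx
      (fun p t => ?_) (fun p l => ?_) (fun n hn l x hx => ?_) (fun m l x hx => ?_)
    · exact gradH_eq_zero_of_tendsto hθU (hstep.mono fun i hi =>
        gradH_eq_zero_of_isRescaling Y hε (hrel _) hi p t (gradH_stepH Y _ p t))
    · have h := (Complex.continuous_im.tendsto _).comp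
        (((continuous_corrC Y p l).tendsto θbar.model).comp hX3)
      exact tendsto_nhds_unique_of_eventuallyEq h tendsto_const_nhds
        (Eventually.of_forall fun i => im_corrC_stepC Y _ p l)
    · refine sub_mul_nonpos_of_tendsto U hε hε1
        (g := fun i l => (sweep ε Y (θ (i - 1))).gTx n l)
        (Q := fun i l => (corrGTx Y (stepGTx ε Y (afterC Y (θ (i - 1)))).model n l).re)
        (γ := θbar.gTx n) (q := fun l => (corrGTx Y θbar.model n l).re)
        (fun i l => (hrel _).2.2.1 n l hn)
        (fun i l x hx => sub_mul_re_corrGTx_nonpos Y hε hε1 _ hn l hx) ?_ ?_ ?_ l hx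
      · have hc : Continuous fun x : Params P N M L T => x.gTx n := by fun_prop
        refine ((hc.tendsto θbar).comp hθU).congr' (hstep.mono fun i hi => ?_)
        obtain ⟨_, _, -, -, -, -, -, -, -, hg, -, -⟩ := hi
        funext l
        simp only [Function.comp, hg, kappaGTx, if_neg hn]
      · exact tendsto_pi_nhds.2 fun l => (Complex.continuous_re.tendsto _).comp
          (((continuous_corrGTx Y n l).tendsto θbar.model).comp hX4)
      · rw [← Complex.re_sum, sum_corrGTx_model]
        simp [haTx]
    · refine sub_mul_nonpos_of_tendsto U hε hε1
        (g := fun i l => (sweep ε Y (θ (i - 1))).gRx m l)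
        (Q := fun i l =>
          (corrGRx Y (stepGRx ε Y (stepGTx ε Y (afterC Y (θ (i - 1))))).model m l).re)
        (γ := θbar.gRx m) (q := fun l => (corrGRx Y θbar.model m l).re)
        (fun i l => (hrel _).2.2.2 m l)
        (fun i l x hx => sub_mul_re_corrGRx_nonpos Y hε hε1 _ m l hx) ?_ ?_ ?_ l hx
      · have hc : Continuous fun x : Params P N M L T => x.gRx m := by fun_prop
        refine ((hc.tendsto θbar).comp hθU).congr' (hstep.mono fun i hi => ?_)
        obtain ⟨_, _, -, -, -, -, -, -, -, -, hg, -⟩ := hi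
        funext l
        simp only [Function.comp, hg, kappaGRx]
      · exact tendsto_pi_nhds.2 fun l => (Complex.continuous_re.tendsto _).comp
          (((continuous_corrGRx Y m l).tendsto θbar.model).comp hX5)
      · rw [← Complex.re_sum, sum_corrGRx_model]
        simp [haRx]
  exact ⟨⟨hbar, hstat.2.1, fun d hd =>
    hstat.2.2 d (posTangentConeAt_mono feasibleSet_subset_relaxedSet hd)⟩, hstat⟩
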